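/- Let $k$ be a field of characteristic zero, $L=k(t,\varepsilon)$, $n\ge 1$, $\mathbf x=(x_0,\dots,x_n)$, and write $\partial_i=\partial/\partial x_i$, $\partial_t=\partial/\partial t$ for the derivations of $L(\mathbf x)$. For $p\in k[t,\varepsilon]$ let $\delta(p)=(\deg_t p,\deg_\varepsilon p)$ (with $\deg 0=0$); for $p\in k[t,\varepsilon][\mathbf x]$ let $\delta(p)$ be the componentwise maximum of the bidegrees of its coefficients; inequalities between bidegrees are componentwise. Let $f\in k[t,\varepsilon][\mathbf x]$ be homogeneous of degree $d$ in $\mathbf x$ such that $L[\mathbf x]/(\partial_0 f,\dots,\partial_n f)$ has finite dimension over $L$. Let $\ell\ge 0$ be an integer and $a\in k[t,\varepsilon][\mathbf x]$ be such that $F=a/f^\ell$ belongs to $L[\mathbf x,\frac1f]_{-n-1}$, the space of homogeneous elements of degree $-n-1$ of $L[\mathbf x,\frac1f]$ (that is, $a$ is zero or homogeneous of degree $\ell d-n-1$ in $\mathbf x$). A telescoper of $F$ with regular certificate is an operator $\sum_{i} b_i\partial_t^i$, $b_i\in L$, such that $\sum_i b_i\partial_t^iF=\sum_{j=0}^n\partial_jA_j$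 for some $A_0,\dots,A_n\in L[\mathbf x,\frac1f]$. Let $T=\sum_{i=0}^r c_i\partial_t^i$ with $c_r\ne0$ be a minimal telescoper of $F$ with regular certificate, i.e. one of least order $r$ among the nonzero ones, normalized so that $c_0,\dots,c_r\in k[t,\varepsilon]$ have no nonunit common divisor in $k[t,\varepsilon]$. Then, with $\mathrm e=\exp(1)$, for every $0\le i\le r$, $$\delta(c_i)\le r\,\delta(a)+(r^2+r\ell)\,\mathrm e^n d^n\,\delta(f).$$ -/

import Mathlib

namespace Telescoping

/-! ### Extending derivations -/

/-- `D` is additive and satisfies the Leibniz rule. -/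
structure IsDerivation {R : Type*} [CommRing R] (D : R → R) : Prop where
  map_add : ∀ x y, D (x + y) = D x + D y
  leibniz : ∀ x y, D (x * y) = x * D y + D x * y

/-- The extension of a derivation `D` of a domain `R` to its fraction field `K`, by the quotient
rule. The value does not depend on the chosen fraction, see `fracDer_div`. -/
noncomputable def fracDer {R : Type*} [CommRing R] (K : Type*) [Field K] [Algebra R K]
    [IsFractionRing R K] (D : R → R) (x : K) : K :=
  let p : R := (IsLocalization.sec (nonZeroDivisors R) x).1
  let q : R := (IsLocalization.sec (nonZeroDivisors R) x).2
  (algebraMap R K (D p) * algebraMap R K q - algebraMap R K p * algebraMap R K (D q)) /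
    algebraMap R K q ^ 2

theorem fracDer_div {R : Type*} [CommRing R] [IsDomain R] (K : Type*) [Field K] [Algebra R K]
    [IsFractionRing R K] {D : R → R} (hD : IsDerivation D) (p q : R) (hq : q ≠ 0) :
    fracDer K D (algebraMap R K p / algebraMap R K q) =
      (algebraMap R K (D p) * algebraMap R K q - algebraMap R K p * algebraMap R K (D q)) /
        algebraMap R K q ^ 2 := by
  have inj := IsFractionRing.injective R K
  set x : K := algebraMap R K p / algebraMap R K q with hx
  have hs := IsLocalization.sec_spec (nonZeroDivisors R) x
  have hv : ((IsLocalization.sec (nonZeroDivisors R) x).2 : R) ≠ 0 :=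
    nonZeroDivisors.ne_zero (IsLocalization.sec (nonZeroDivisors R) x).2.2
  simp only [fracDer]
  generalize (IsLocalization.sec (nonZeroDivisors R) x).1 = u at *
  generalize ((IsLocalization.sec (nonZeroDivisors R) x).2 : R) = v at *
  have hq' : algebraMap R K q ≠ 0 := fun h => hq (inj (by rw [h, map_zero]))
  have hv' : algebraMap R K v ≠ 0 := fun h => hv (inj (by rw [h, map_zero]))
  have e : p * v = u * q := by
    apply inj
    rw [map_mul, map_mul, ← hs, hx]
    field_simp
  have e1 := congrArg D e
  rw [hD.leibniz, hD.leibniz] at e1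
  have E := congrArg (algebraMap R K) e
  have E1 := congrArg (algebraMap R K) e1
  simp only [map_add, map_mul] at E E1
  rw [div_eq_div_iff (pow_ne_zero 2 hv') (pow_ne_zero 2 hq')]
  linear_combination (-(algebraMap R K q) * algebraMap R K v) * E1 +
    (algebraMap R K v * algebraMap R K (D q) + algebraMap R K q * algebraMap R K (D v)) * E

/-- Apply a map to each coefficient of a polynomial. -/
noncomputable def mapCoeff {σ L : Type*} [CommRing L] (D : L → L) (p : MvPolynomial σ L) :
    MvPolynomial σ L :=
  ∑ m ∈ p.support, MvPolynomial.monomial m (D (p.coeff m))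

/-! ### The rings and fields

`k[t, ε]` is `MvPolynomial (Fin 2) k` with `t = X 0` and `ε = X 1`. Below, `L` is a fraction field
`k(t, ε)` of it, the ring `L[x] = L[x₀, …, xₙ]` is `MvPolynomial (Fin (n + 1)) L`, and `K` is a
fraction field `L(x)` of that ring. -/

/-- The ring `k[t, ε]`. -/
abbrev ParamRing (k : Type*) [Field k] := MvPolynomial (Fin 2) k

/-- The derivation `∂/∂t` of `L = k(t, ε)`. -/
noncomputable def dtField (k L : Type*) [Field k] [Field L] [Algebra (ParamRing k) L]
    [IsFractionRing (ParamRing k) L] : L → L :=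
  fracDer L fun p : ParamRing k => MvPolynomial.pderiv 0 p

/-- The derivation `∂/∂t` of `K = L(x)`. -/
noncomputable def dt (k L K : Type*) [Field k] [Field L] [Algebra (ParamRing k) L]
    [IsFractionRing (ParamRing k) L] {n : ℕ} [Field K] [Algebra (MvPolynomial (Fin (n + 1)) L) K]
    [IsFractionRing (MvPolynomial (Fin (n + 1)) L) K] : K → K :=
  fracDer K fun p : MvPolynomial (Fin (n + 1)) L => mapCoeff (dtField k L) p

section RationalFunctions

variable {L : Type*} (K : Type*) [Field L] {n : ℕ} [Field K]
  [Algebra (MvPolynomial (Fin (n + 1)) L) K]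

/-- The derivation `∂/∂xᵢ` of `K = L(x)`. -/
noncomputable def dx [IsFractionRing (MvPolynomial (Fin (n + 1)) L) K] (i : Fin (n + 1)) :
    K → K :=
  fracDer K fun p : MvPolynomial (Fin (n + 1)) L => MvPolynomial.pderiv i p

/-- The fraction `g / f ^ m` in `K = L(x)`. -/
noncomputable def frac (g f : MvPolynomial (Fin (n + 1)) L) (m : ℕ) : K :=
  algebraMap _ K g / algebraMap _ K f ^ m

/-- `G` belongs to `L[x, 1/f]`: it is a rational function without poles outside `f = 0`. -/
def IsRegularAway (f : MvPolynomial (Fin (n + 1)) L) (G : K) : Prop :=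
  ∃ (g : MvPolynomial (Fin (n + 1)) L) (m : ℕ), G = frac K g f m

/-- For `f` homogeneous of degree `d`: `G` belongs to `L[x, 1/f]_p`, the space of homogeneous
elements of degree `p` (possibly negative) of `L[x, 1/f]`. -/
def IsHomogeneousAway (f : MvPolynomial (Fin (n + 1)) L) (d : ℕ) (p : ℤ) (G : K) : Prop :=
  ∃ (g : MvPolynomial (Fin (n + 1)) L) (m e : ℕ),
    g.IsHomogeneous e ∧ (e : ℤ) = p + m * d ∧ G = frac K g f m

end RationalFunctions

/-- The Jacobian ideal of `f`, generated by all its partial derivatives. -/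
noncomputable def jacobianIdeal {L : Type*} [Field L] {n : ℕ}
    (f : MvPolynomial (Fin (n + 1)) L) : Ideal (MvPolynomial (Fin (n + 1)) L) :=
  Ideal.span (Set.range fun i => MvPolynomial.pderiv i f)

/-- The regularity hypothesis: `L[x] / Jac f` has finite dimension over `L`. -/
def IsRegularPoly {L : Type*} [Field L] {n : ℕ} (f : MvPolynomial (Fin (n + 1)) L) : Prop :=
  Module.Finite L (MvPolynomial (Fin (n + 1)) L ⧸ jacobianIdeal f)

/-! ### Telescopers -/

section Telescopers

variable (k : Type*) {L K : Type*} [Field k] [Field L] [Algebra (ParamRing k) L]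
  [IsFractionRing (ParamRing k) L] {n r : ℕ} [Field K]
  [Algebra (MvPolynomial (Fin (n + 1)) L) K] [IsFractionRing (MvPolynomial (Fin (n + 1)) L) K]

/-- `∑ i ≤ r, cᵢ ∂ₜ^i` is a telescoper of `F` with a certificate in `L[x, 1/f]`. -/
def HasRegularCertificate (f : MvPolynomial (Fin (n + 1)) L) (F : K) (c : Fin (r + 1) → L) :
    Prop :=
  ∃ A : Fin (n + 1) → K, (∀ j, IsRegularAway K f (A j)) ∧
    ∑ i : Fin (r + 1),
      algebraMap (MvPolynomial (Fin (n + 1)) L) K (MvPolynomial.C (c i)) *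
        (dt k L K (n := n))^[i] F =
    ∑ j, dx K (L := L) j (A j)

/-- `∑ i ≤ r, cᵢ ∂ₜ^i` is a telescoper of `F` with regular certificate, it has order exactly `r`,
and no nonzero one has smaller order. -/
structure IsMinimalTelescoper (f : MvPolynomial (Fin (n + 1)) L) (F : K)
    (c : Fin (r + 1) → L) : Prop where
  leading_ne_zero : c (Fin.last r) ≠ 0
  telescoper : HasRegularCertificate k f F c
  minimal : ∀ (s : ℕ) (b : Fin (s + 1) → L),
    b (Fin.last s) ≠ 0 → HasRegularCertificate k f F b → r ≤ s

end Telescopers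

/-- The components of the bidegree `δ(p)` of `p ∈ k[t, ε][x]`: the largest degree in `t` (`v = 0`)
or in `ε` (`v = 1`) of a coefficient of `p`. -/
noncomputable def paramDegree {k : Type*} [Field k] {n : ℕ} (v : Fin 2)
    (p : MvPolynomial (Fin (n + 1)) (ParamRing k)) : ℕ :=
  p.support.sup fun m => (p.coeff m).degreeOf v

end Telescoping

/-! Modulo exact functions, a fraction `u / f^q` has a normal form computed by linear algebra. If `u
= ρ + ∑ b_j ∂_j f` and `q ≥ 2`, then `u / f^q` is equivalent to `ρ / f^q + (∑ ∂_j b_j) / ((q - 1)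
f^(q-1))` (Griffiths–Dwork, `isExact_griffiths_dwork`). Iterating leads to a sum of `ρ_s / f^s` in
which, for `s ≥ 2`, `ρ_s` only involves monomials spanning a complement of the Jacobian ideal
(`exists_normalForm`). This form is unique (`normalForm_unique`). Regularity of `f` implies that its
partial derivatives have only Koszul syzygies (`trivialSyzygies_of_radical`); then the pole order of
a certificate can be lowered until the numerator of an exact fraction is seen to lie in the Jacobian
ideal (`griffiths`). Hence telescopers of `F` are the linear relations between the normal forms of
`F, ∂_t F, ∂_t² F, …` (`exists_derivative_normalForms`).

Each reduction step solves a Macaulay linear system by Cramer's rule (`exists_macaulay_reduction`).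
Its rank is at most `N = binom((n+1)d - 1, n) ≤ e^n d^n`, so it costs a denominator of degree at
most `N δ(f)`. Since forms of degree at least `(n+1)(d-1)` lie in the Jacobian ideal
(`homZ_le_span_of_radical`), the same `N` serves for all pole orders (`exists_reducer`).

By minimality the first `r` normal forms are independent, so the relation of order `r` is unique up
to a factor and given by maximal minors. A primitive solution divides the polynomial one built from
these minors (`dvd_of_primitive`), and adding the degrees of the columns gives the bound
(`degreeOf_minimalTelescoper_le`). -/

namespace Telescoping

open MvPolynomial

/-! ### Polynomials homogeneous of an integer degree -/

section HomZ

variable {σ R : Type*} [CommRing R]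

/-- Polynomials homogeneous of degree `D ∈ ℤ`; only `0` if `D < 0`. -/
def homZ (σ R : Type*) [CommRing R] (D : ℤ) : Submodule R (MvPolynomial σ R) where
  carrier := {p | ∀ m, p.coeff m ≠ 0 → (m.degree : ℤ) = D}
  add_mem' := by
    intro p q hp hq m hm
    by_cases h : p.coeff m = 0
    · exact hq m (by rwa [coeff_add, h, zero_add] at hm)
    · exact hp m h
  zero_mem' := by simp
  smul_mem' := by
    intro c p hp m hm
    refine hp m fun h => hm ?_
    rw [coeff_smul, h, smul_zero]

theorem IsHomogeneous.mem_homZ {p : MvPolynomial σ R} {e : ℕ} (h : p.IsHomogeneous e) :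
    p ∈ homZ σ R e := fun m hm => by
  by_contra h'
  exact hm (h.coeff_eq_zero (fun h'' => h' (by exact_mod_cast h'')))

theorem homZ_natCast (e : ℕ) : homZ σ R e = homogeneousSubmodule σ R e := by
  ext p
  refine ⟨fun h => ?_, fun h => IsHomogeneous.mem_homZ ((mem_homogeneousSubmodule _ _).1 h)⟩
  rw [mem_homogeneousSubmodule]
  intro m hm
  have := h m hm
  have h1 : m.degree = e := by exact_mod_cast this
  rw [← h1, Finsupp.degree_eq_weight_one]
  rfl

/-- This is the benefit of integer degrees: numerators over low powers of `f` have degree `s d - n -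
1`, and they vanish automatically when it is negative. -/
theorem homZ_neg {D : ℤ} (hD : D < 0) {p : MvPolynomial σ R} (hp : p ∈ homZ σ R D) : p = 0 := by
  ext m
  by_contra h
  have := hp m h
  omega

theorem mul_mem_homZ {D E F : ℤ} {p q : MvPolynomial σ R} (hp : p ∈ homZ σ R D)
    (hq : q ∈ homZ σ R E) (h : D + E = F) : p * q ∈ homZ σ R F := by
  classical
  intro m hm
  rw [coeff_mul] at hm
  obtain ⟨x, hx, hne⟩ := Finset.exists_ne_zero_of_sum_ne_zero hm
  have h1 := hp x.1 (left_ne_zero_of_mul hne)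
  have h2 := hq x.2 (right_ne_zero_of_mul hne)
  rw [← Finset.HasAntidiagonal.mem_antidiagonal.1 hx, map_add]
  push_cast
  omega

theorem monomial_mem_homZ {m : σ →₀ ℕ} {D : ℤ} (h : (m.degree : ℤ) = D) (c : R) :
    monomial m c ∈ homZ σ R D := by
  classical
  intro m' hm'
  rw [coeff_monomial] at hm'
  split_ifs at hm' with h'
  · rw [← h', h]
  · exact absurd rfl hm'

theorem X_mem_homZ (i : σ) : (X i : MvPolynomial σ R) ∈ homZ σ R 1 :=
  monomial_mem_homZ (by simp) 1

theorem C_mem_homZ (c : R) : (C c : MvPolynomial σ R) ∈ homZ σ R 0 :=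
  monomial_mem_homZ (by simp) c

theorem pow_mem_homZ {D : ℤ} {p : MvPolynomial σ R} (hp : p ∈ homZ σ R D) (k : ℕ) :
    p ^ k ∈ homZ σ R (k * D) := by
  induction k with
  | zero => simpa using C_mem_homZ (σ := σ) (1 : R)
  | succ k ih =>
    rw [pow_succ]
    exact mul_mem_homZ ih hp (by push_cast; ring)

theorem pderiv_mem_homZ {D E : ℤ} {p : MvPolynomial σ R} (hp : p ∈ homZ σ R D) (i : σ)
    (h : D - 1 = E) : pderiv i p ∈ homZ σ R E := by
  intro m hm
  rw [coeff_pderiv] at hm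
  have := hp _ (left_ne_zero_of_mul hm)
  rw [map_add, Finsupp.degree_single] at this
  push_cast at this
  omega

open Classical in
/-- The component of degree `D ∈ ℤ`. -/
noncomputable def homComp (D : ℤ) : MvPolynomial σ R →ₗ[R] MvPolynomial σ R where
  toFun p := if 0 ≤ D then homogeneousComponent D.toNat p else 0
  map_add' p q := by split_ifs <;> simp
  map_smul' c p := by split_ifs <;> simp

theorem coeff_homComp (D : ℤ) (p : MvPolynomial σ R) (m : σ →₀ ℕ) [Decidable ((m.degree : ℤ) = D)] :
    coeff m (homComp D p) = if (m.degree : ℤ) = D then coeff m p else 0 := by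
  simp only [homComp, LinearMap.coe_mk, AddHom.coe_mk]
  split_ifs with h1 h2 h2
  · rw [coeff_homogeneousComponent, if_pos (by omega)]
  · rw [coeff_homogeneousComponent, if_neg (by omega)]
  · omega
  · simp

theorem homComp_mem (D : ℤ) (p : MvPolynomial σ R) : homComp D p ∈ homZ σ R D := by
  classical
  intro m hm
  rw [coeff_homComp] at hm
  by_contra h
  exact hm (if_neg h)

theorem homComp_of_mem {D : ℤ} {p : MvPolynomial σ R} (hp : p ∈ homZ σ R D) :
    homComp D p = p := by
  classical
  ext m
  rw [coeff_homComp]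
  split_ifs with h
  · rfl
  · by_contra h'
    exact h (hp m (Ne.symm h'))

theorem homComp_of_mem_ne {D E : ℤ} {p : MvPolynomial σ R} (hp : p ∈ homZ σ R D) (h : D ≠ E) :
    homComp E p = 0 := by
  classical
  ext m
  rw [coeff_homComp, coeff_zero]
  split_ifs with h1
  · by_contra h'
    exact h ((hp m h').symm.trans h1)
  · rfl

/-- Used to project identities onto one degree, so that unknown coefficients in front of homogeneous
generators may be taken homogeneous. -/
theorem homComp_mul {D E F : ℤ} {p q : MvPolynomial σ R} (hq : q ∈ homZ σ R E) (h : D + E = F) :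
    homComp F (p * q) = homComp D p * q := by
  classical
  ext m
  rw [coeff_homComp, coeff_mul, coeff_mul]
  have key : ∀ x ∈ Finset.HasAntidiagonal.antidiagonal m, coeff x.1 (homComp D p) * coeff x.2 q =
      if (m.degree : ℤ) = F then coeff x.1 p * coeff x.2 q else 0 := by
    intro x hx
    by_cases h0 : coeff x.2 q = 0
    · simp [h0]
    have h2 := hq _ h0
    have h3 : (m.degree : ℤ) = x.1.degree + x.2.degree := by
      rw [← Finset.HasAntidiagonal.mem_antidiagonal.1 hx, map_add]; push_cast; rfl
    rw [coeff_homComp]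
    by_cases h1 : (x.1.degree : ℤ) = D
    · rw [if_pos h1, if_pos (by omega)]
    · rw [if_neg h1, if_neg (by omega), zero_mul]
  rw [Finset.sum_congr rfl key]
  split_ifs <;> simp

theorem homComp_pderiv {D E : ℤ} (p : MvPolynomial σ R) (i : σ) (h : D - 1 = E) :
    homComp E (pderiv i p) = pderiv i (homComp D p) := by
  classical
  ext m
  rw [coeff_homComp, coeff_pderiv, coeff_pderiv, coeff_homComp, map_add, Finsupp.degree_single]
  push_cast
  by_cases h1 : (m.degree : ℤ) = E
  · rw [if_pos h1, if_pos (by omega)]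
  · rw [if_neg h1, if_neg (by omega), zero_mul]

theorem map_mem_homZ {T : Type*} [CommRing T] (φ : R →+* T) {D : ℤ} {p : MvPolynomial σ R}
    (hp : p ∈ homZ σ R D) : map φ p ∈ homZ σ T D := by
  intro m hm
  refine hp m fun h => hm ?_
  rw [coeff_map, h, map_zero]

theorem euler_homZ [Fintype σ] {D : ℤ} {p : MvPolynomial σ R} (hp : p ∈ homZ σ R D) :
    ∑ i, X i * pderiv i p = (D : MvPolynomial σ R) * p := by
  by_cases hD : D < 0
  · simp [homZ_neg hD hp]
  obtain ⟨e, rfl⟩ := Int.eq_ofNat_of_zero_le (not_lt.1 hD)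
  rw [homZ_natCast, mem_homogeneousSubmodule] at hp
  rw [hp.sum_X_mul_pderiv]
  simp

theorem pderiv_pderiv_comm (i j : σ) (p : MvPolynomial σ R) :
    pderiv i (pderiv j p) = pderiv j (pderiv i p) := by
  classical
  ext m
  by_cases h : i = j
  · rw [h]
  simp only [coeff_pderiv, Finsupp.add_apply, Finsupp.single_apply]
  rw [if_neg h, if_neg (Ne.symm h), add_right_comm]
  push_cast
  ring

theorem span_homZ_homogeneous {ι : Type*} [Fintype ι] {e : ℤ} {F : ι → MvPolynomial σ R}
    (hF : ∀ i, F i ∈ homZ σ R e) {D : ℤ} {u : MvPolynomial σ R} (hu : u ∈ homZ σ R D)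
    (hmem : u ∈ Ideal.span (Set.range F)) :
    ∃ b : ι → MvPolynomial σ R, (∀ i, b i ∈ homZ σ R (D - e)) ∧ u = ∑ i, b i * F i := by
  obtain ⟨c, hc⟩ := (Ideal.mem_span_range_iff_exists_fun).1 hmem
  refine ⟨fun i => homComp (D - e) (c i), fun i => homComp_mem _ _, ?_⟩
  rw [← homComp_of_mem hu, ← hc, map_sum]
  exact Finset.sum_congr rfl fun i _ => homComp_mul (hF i) (by ring)

end HomZ

/-! ### Syzygies and the Griffiths–Dwork pole order reduction -/

/-- The relations between the `F i` are generated by the obvious ones. -/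
def TrivialSyzygies {ι S : Type*} [Fintype ι] [CommRing S] (F : ι → S) : Prop :=
  ∀ b : ι → S, ∑ i, b i * F i = 0 → ∃ s : ι → ι → S, (∀ i j, s i j = -s j i) ∧
    ∀ i, b i = ∑ j, s i j * F j

theorem TrivialSyzygies.homogeneous {σ R ι : Type*} [CommRing R] [Fintype ι]
    {F : ι → MvPolynomial σ R} (h : TrivialSyzygies F) {e D : ℤ} (hF : ∀ i, F i ∈ homZ σ R e)
    {b : ι → MvPolynomial σ R} (hb : ∀ i, b i ∈ homZ σ R D) (h0 : ∑ i, b i * F i = 0) :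
    ∃ s : ι → ι → MvPolynomial σ R, (∀ i j, s i j ∈ homZ σ R (D - e)) ∧ (∀ i j, s i j = -s j i) ∧
      ∀ i, b i = ∑ j, s i j * F j := by
  obtain ⟨s, h2, h3⟩ := h b h0
  refine ⟨fun i j => homComp (D - e) (s i j), fun i j => homComp_mem _ _, fun i j => ?_,
    fun i => ?_⟩
  · change homComp _ (s i j) = -homComp _ (s j i)
    rw [h2, map_neg]
  · rw [← homComp_of_mem (hb i), h3, map_sum]
    exact Finset.sum_congr rfl fun j _ => homComp_mul (hF j) (by ring)

/-- Exchanging the indices changes the sign. It is applied to a Koszul matrix against the Hessian of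
`f`. -/
theorem sum_antisymm_mul_symm {ι S : Type*} [Fintype ι] [CommRing S] [IsDomain S] [CharZero S]
    {s t : ι → ι → S}
    (hs : ∀ i j, s i j = -s j i) (ht : ∀ i j, t i j = t j i) : ∑ i, ∑ j, s i j * t i j = 0 := by
  have h : ∑ i, ∑ j, s i j * t i j = -∑ i, ∑ j, s i j * t i j := by
    conv_lhs => rw [Finset.sum_comm]
    rw [← Finset.sum_neg_distrib]
    refine Finset.sum_congr rfl fun i _ => ?_
    rw [← Finset.sum_neg_distrib]
    refine Finset.sum_congr rfl fun j _ => ?_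
    rw [hs j i, ht j i]
    ring
  exact self_eq_neg.1 h

variable {L : Type*} [Field L] [CharZero L] {n : ℕ}

/-- If `u / f ^ q` is the divergence of a vector field with poles of order `s ≥ q`, then the pole
order of the vector field may be lowered to `s - 1`. -/
theorem griffiths_step {f : MvPolynomial (Fin (n + 1)) L} {d : ℕ} (hd : 1 ≤ d) (hn : 1 ≤ n)
    (hf : f ∈ homZ (Fin (n + 1)) L d) (hsyz : TrivialSyzygies fun i => pderiv i f)
    {q s : ℕ} (hs : 1 ≤ s) (hq : q ≤ s) {u : MvPolynomial (Fin (n + 1)) L}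
    (hu : u ∈ homZ (Fin (n + 1)) L (q * d - n - 1)) {g : Fin (n + 1) → MvPolynomial (Fin (n + 1)) L}
    (hg : ∀ j, g j ∈ homZ (Fin (n + 1)) L (s * d - n))
    (h : u * f ^ (s + 1 - q) = ∑ j, (f * pderiv j (g j) - (s : MvPolynomial _ L) * g j * pderiv j f)) :
    ∃ g' : Fin (n + 1) → MvPolynomial (Fin (n + 1)) L,
      (∀ j, g' j ∈ homZ (Fin (n + 1)) L ((s - 1 : ℕ) * d - n)) ∧
      u * f ^ (s - q) =
        ∑ j, (f * pderiv j (g' j) - ((s - 1 : ℕ) : MvPolynomial _ L) * g' j * pderiv j f) := by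
  have hs0 : (s : L) ≠ 0 := by exact_mod_cast (by omega : s ≠ 0)
  have hd0 : (d : L) ≠ 0 := by exact_mod_cast (by omega : d ≠ 0)
  have hsC : C (s : L)⁻¹ * (s : MvPolynomial (Fin (n + 1)) L) = 1 := by
    rw [← map_natCast (C : L →+* MvPolynomial (Fin (n + 1)) L), ← map_mul, inv_mul_cancel₀ hs0,
      map_one]
  have hdC : C (d : L)⁻¹ * (d : MvPolynomial (Fin (n + 1)) L) = 1 := by
    rw [← map_natCast (C : L →+* MvPolynomial (Fin (n + 1)) L), ← map_mul, inv_mul_cancel₀ hd0,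
      map_one]
  have hf1 : ∀ j, pderiv j f ∈ homZ (Fin (n + 1)) L ((d : ℤ) - 1) := fun j =>
    pderiv_mem_homZ hf j rfl
  set v := u * f ^ (s - q) with hv
  have hvdeg : v ∈ homZ (Fin (n + 1)) L (s * d - n - 1) :=
    mul_mem_homZ hu (pow_mem_homZ hf _) (by push_cast [hq]; ring)
  set G := ∑ j, pderiv j (g j) with hG
  have hGdeg : G ∈ homZ (Fin (n + 1)) L (s * d - n - 1) :=
    Submodule.sum_mem _ fun j _ => pderiv_mem_homZ (hg j) j rfl
  -- The hypothesis says that `s ∑ g_j ∂_j f = f (G - v)`, so `w` is the quotient of `∑ g_j ∂_j f`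
  -- by `f`.
  set w := C (s : L)⁻¹ * (G - v) with hw
  have hwdeg : w ∈ homZ (Fin (n + 1)) L (s * d - n - 1) :=
    mul_mem_homZ (C_mem_homZ _) (Submodule.sub_mem _ hGdeg hvdeg) (by ring)
  have hsw : (s : MvPolynomial (Fin (n + 1)) L) * w = G - v := by
    rw [hw]; linear_combination (G - v) * hsC
  have hvf : u * f ^ (s + 1 - q) = f * v := by
    rw [hv, show s + 1 - q = (s - q) + 1 by omega]; ring
  have hgf : ∑ j, g j * pderiv j f = f * w := by
    rw [hvf, Finset.sum_sub_distrib, ← Finset.mul_sum, ← hG] at h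
    have : ∑ j, (s : MvPolynomial (Fin (n + 1)) L) * g j * pderiv j f =
        s * ∑ j, g j * pderiv j f := by
      rw [Finset.mul_sum]; exact Finset.sum_congr rfl fun j _ => by ring
    rw [this] at h
    rw [hw]
    linear_combination C (s : L)⁻¹ * h - (∑ j, g j * pderiv j f) * hsC
  have heul := euler_homZ hf
  have heulw := euler_homZ hwdeg
  push_cast at heul heulw
  -- By Euler's relation the radial field `X j * w / d` also solves `∑ g_j ∂_j f = f w`; its
  -- difference with `g` is a syzygy, hence a Koszul one.
  obtain ⟨σ, hσdeg, hσ, hgσ⟩ := hsyz.homogeneous hf1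
    (b := fun j => g j - C (d : L)⁻¹ * (X j * w)) (D := s * d - n)
    (fun j => Submodule.sub_mem _ (hg j)
      (mul_mem_homZ (C_mem_homZ _) (mul_mem_homZ (X_mem_homZ j) hwdeg rfl) (by ring))) (by
      simp only [sub_mul, Finset.sum_sub_distrib, hgf]
      have : ∑ j, C (d : L)⁻¹ * (X j * w) * pderiv j f =
          C (d : L)⁻¹ * w * ∑ j, X j * pderiv j f := by
        rw [Finset.mul_sum]; exact Finset.sum_congr rfl fun j _ => by ring
      rw [this, heul]
      linear_combination (-f * w) * hdC)
  have hdiv : G = C (d : L)⁻¹ * (((n : MvPolynomial (Fin (n + 1)) L) + 1) * w + ∑ j, X j * pderiv j w) +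
      ∑ j, ∑ k, pderiv j (σ j k) * pderiv k f := by
    have hgj : ∀ j, pderiv j (g j) = C (d : L)⁻¹ * (w + X j * pderiv j w) +
        (∑ k, pderiv j (σ j k) * pderiv k f + ∑ k, σ j k * pderiv j (pderiv k f)) := by
      intro j
      have : g j = C (d : L)⁻¹ * (X j * w) + ∑ k, σ j k * pderiv k f := by
        rw [← hgσ j]; ring
      rw [this, map_add, map_sum, pderiv_C_mul, pderiv_mul, pderiv_X_self,
        ← Finset.sum_add_distrib]
      simp only [pderiv_mul, one_mul]
    rw [hG, Finset.sum_congr rfl fun j _ => hgj j, Finset.sum_add_distrib, Finset.sum_add_distrib,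
      sum_antisymm_mul_symm hσ fun j k => pderiv_pderiv_comm j k f, ← Finset.mul_sum,
      Finset.sum_add_distrib]
    simp
  -- Since `w` has degree `s d - n - 1`, the radial field has divergence `((n + 1) + (s d - n - 1))
  -- w / d = s w`. It cancels in `v = G - s w`.
  have hvσ : v = ∑ k, (∑ j, pderiv j (σ j k)) * pderiv k f := by
    have : ∑ k, (∑ j, pderiv j (σ j k)) * pderiv k f =
        ∑ j, ∑ k, pderiv j (σ j k) * pderiv k f := by
      rw [Finset.sum_comm]; exact Finset.sum_congr rfl fun k _ => by rw [Finset.sum_mul]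
    rw [this]
    rw [heulw] at hdiv
    linear_combination hdiv + hsw + s * w * hdC
  -- For `s = 1` division by `s - 1` is impossible, but then `∂_j σ_jk` has degree `-n < 0` and
  -- everything vanishes.
  by_cases h1 : s = 1
  · have hσ0 : ∀ j k, pderiv j (σ j k) = 0 := fun j k =>
      homZ_neg (D := -n) (by omega)
        (pderiv_mem_homZ (hσdeg j k) j (by rw [h1]; push_cast; ring))
    refine ⟨0, fun j => by simp, ?_⟩
    rw [hvσ]
    simp [hσ0]
  · have hs1 : ((s - 1 : ℕ) : L) ≠ 0 := by exact_mod_cast (by omega : s - 1 ≠ 0)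
    have hs1C : C ((s - 1 : ℕ) : L)⁻¹ * ((s - 1 : ℕ) : MvPolynomial (Fin (n + 1)) L) = 1 := by
      rw [← map_natCast (C : L →+* MvPolynomial (Fin (n + 1)) L), ← map_mul, inv_mul_cancel₀ hs1,
        map_one]
    -- The field `∑ j, ∂_j σ_jk` is divergence free because `σ` is antisymmetric, so only the term
    -- in `∂_k f` survives; the scalar cancels its factor `-(s - 1)`.
    refine ⟨fun k => C (-((s - 1 : ℕ) : L)⁻¹) * ∑ j, pderiv j (σ j k), fun k => ?_, ?_⟩
    · refine mul_mem_homZ (C_mem_homZ _) (Submodule.sum_mem _ fun j _ =>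
        pderiv_mem_homZ (hσdeg j k) j rfl) ?_
      push_cast [hs]
      ring
    · have h0 : ∑ k, pderiv k (C (-((s - 1 : ℕ) : L)⁻¹) * ∑ j, pderiv j (σ j k)) = 0 := by
        simp only [pderiv_C_mul, map_sum, ← Finset.mul_sum]
        have : ∑ k, ∑ j, pderiv k (pderiv j (σ j k)) = -∑ k, ∑ j, pderiv k (pderiv j (σ j k)) := by
          conv_lhs => rw [Finset.sum_comm]
          rw [← Finset.sum_neg_distrib]
          refine Finset.sum_congr rfl fun k _ => ?_
          rw [← Finset.sum_neg_distrib]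
          refine Finset.sum_congr rfl fun j _ => ?_
          rw [hσ k j, pderiv_pderiv_comm, map_neg, map_neg]
        rw [self_eq_neg.1 this, mul_zero]
      rw [Finset.sum_sub_distrib, ← Finset.mul_sum, h0, mul_zero, zero_sub, hvσ,
        ← Finset.sum_neg_distrib]
      refine Finset.sum_congr rfl fun k _ => ?_
      rw [map_neg]
      linear_combination (-(∑ j, pderiv j (σ j k)) * pderiv k f) * hs1C

theorem self_mem_jacobianIdeal {f : MvPolynomial (Fin (n + 1)) L} {d : ℕ} (hd : 1 ≤ d)
    (hf : f ∈ homZ (Fin (n + 1)) L d) : f ∈ jacobianIdeal f := by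
  have hd0 : (d : L) ≠ 0 := by exact_mod_cast (by omega : d ≠ 0)
  have h := euler_homZ hf
  have : f = C (d : L)⁻¹ * ∑ i, X i * pderiv i f := by
    rw [h, Int.cast_natCast, ← map_natCast (C : L →+* MvPolynomial (Fin (n + 1)) L), ← mul_assoc,
      ← map_mul, inv_mul_cancel₀ hd0, map_one, one_mul]
  have h1 : C (d : L)⁻¹ * ∑ i, X i * pderiv i f ∈ jacobianIdeal f :=
    Ideal.mul_mem_left _ _ (Ideal.sum_mem _ fun i _ =>
    Ideal.mul_mem_left _ _ (Ideal.subset_span ⟨i, rfl⟩))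
  rwa [← this] at h1

/-- If `u / f ^ q` is a divergence, then `u` is in the Jacobian ideal, and `u = 0` if `q ≤ 1`. -/
theorem griffiths {f : MvPolynomial (Fin (n + 1)) L} {d : ℕ} (hd : 1 ≤ d) (hn : 1 ≤ n)
    (hf : f ∈ homZ (Fin (n + 1)) L d) (hsyz : TrivialSyzygies fun i => pderiv i f)
    {q s : ℕ} (hq : q ≤ s) {u : MvPolynomial (Fin (n + 1)) L}
    (hu : u ∈ homZ (Fin (n + 1)) L (q * d - n - 1)) {g : Fin (n + 1) → MvPolynomial (Fin (n + 1)) L}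
    (h : u * f ^ (s + 1 - q) = ∑ j, (f * pderiv j (g j) - (s : MvPolynomial _ L) * g j * pderiv j f)) :
    u ∈ jacobianIdeal f ∧ (q ≤ 1 → u = 0) := by
  by_cases hq0 : q = 0
  · have : u = 0 := homZ_neg (by rw [hq0]; push_cast; omega) hu
    exact ⟨this ▸ Ideal.zero_mem _, fun _ => this⟩
  have hf1 : ∀ j, pderiv j f ∈ homZ (Fin (n + 1)) L ((d : ℤ) - 1) := fun j =>
    pderiv_mem_homZ hf j rfl
  have hhom : ∃ g : Fin (n + 1) → MvPolynomial (Fin (n + 1)) L,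
      (∀ j, g j ∈ homZ (Fin (n + 1)) L (s * d - n)) ∧ u * f ^ (s + 1 - q) =
        ∑ j, (f * pderiv j (g j) - (s : MvPolynomial _ L) * g j * pderiv j f) := by
    refine ⟨fun j => homComp (s * d - n) (g j), fun j => homComp_mem _ _, ?_⟩
    have hdeg : u * f ^ (s + 1 - q) ∈ homZ (Fin (n + 1)) L ((s + 1) * d - n - 1) :=
      mul_mem_homZ hu (pow_mem_homZ hf _) (by push_cast [show q ≤ s + 1 by omega]; ring)
    rw [← homComp_of_mem hdeg, h, map_sum]
    refine Finset.sum_congr rfl fun j _ => ?_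
    rw [map_sub, mul_comm f, homComp_mul (D := s * d - n - 1) hf (by ring),
      homComp_pderiv (D := s * d - n) _ _ rfl,
      homComp_mul (D := s * d - n) (hf1 j) (by ring), mul_comm f,
      ← map_natCast (C : L →+* MvPolynomial (Fin (n + 1)) L), C_mul', C_mul', map_smul]
  have key : ∀ t : ℕ, t + q ≤ s + 1 → ∃ g : Fin (n + 1) → MvPolynomial (Fin (n + 1)) L,
      (∀ j, g j ∈ homZ (Fin (n + 1)) L ((s - t : ℕ) * d - n)) ∧ u * f ^ (s - t + 1 - q) =
        ∑ j, (f * pderiv j (g j) - ((s - t : ℕ) : MvPolynomial _ L) * g j * pderiv j f) := by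
    intro t
    induction t with
    | zero => intro _; exact hhom
    | succ t ih =>
      intro ht
      obtain ⟨g, hg, hgu⟩ := ih (by omega)
      obtain ⟨g', hg', hgu'⟩ := griffiths_step hd hn hf hsyz (by omega) (by omega) hu hg hgu
      refine ⟨g', hg', ?_⟩
      rw [show s - (t + 1) + 1 - q = s - t - q by omega, hgu']
      rfl
  -- The descent ends at pole order `q - 1`, where `f` occurs on the left to the power `0`. The
  -- right side lies in the Jacobian ideal because `f` does, by Euler.
  obtain ⟨g, hg, hgu⟩ := key (s + 1 - q) (by omega)
  have e1 : s - (s + 1 - q) = q - 1 := by omega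
  rw [e1] at hg hgu
  rw [show q - 1 + 1 - q = 0 by omega, pow_zero, mul_one] at hgu
  constructor
  · rw [hgu]
    refine Ideal.sum_mem _ fun j _ => Ideal.sub_mem _
      (Ideal.mul_mem_right _ _ (self_mem_jacobianIdeal hd hf))
      (Ideal.mul_mem_left _ _ (Ideal.subset_span ⟨j, rfl⟩))
  · intro hq1
    have : ∀ j, g j = 0 := fun j => homZ_neg (D := -n) (by omega) (by
      have := hg j
      rw [show q - 1 = 0 by omega] at this
      simpa using this)
    rw [hgu]
    simp [this]

end Telescoping

namespace Telescoping

open MvPolynomial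

/-! ### Regular sequences of linear combinations of generators -/

section Rees

universe u

open CategoryTheory Abelian RingTheory.Sequence Pointwise

variable {L : Type*} {S : Type u} [Field L] [Infinite L] [CommRing S] [Algebra L S]
  [IsNoetherianRing S]

/-- Zero divisors on `M` form a finite union of associated primes. None of these contains `V`, as it
would contain `r`, and a vector space over an infinite field is not a finite union of proper
subspaces. -/
theorem exists_isSMulRegular_mem_submodule (V : Submodule L S) {M : Type*} [AddCommGroup M]
    [Module S M] [Module.Finite S M] {r : S} (hr : r ∈ Ideal.span (V : Set S))
    (hreg : IsSMulRegular M r) : ∃ v ∈ V, IsSMulRegular M v := by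
  classical
  have hfin := associatedPrimes.finite S M
  have hU := biUnion_associatedPrimes_eq_compl_regular S M
  let W : Ideal S → Subspace L V := fun p => (p.restrictScalars L).comap V.subtype
  have htop : ⊤ ∉ hfin.toFinset.image W := by
    intro h
    obtain ⟨p, hp, hpt⟩ := Finset.mem_image.1 h
    rw [Set.Finite.mem_toFinset] at hp
    have hVp : Ideal.span (V : Set S) ≤ p := by
      refine Ideal.span_le.2 fun v hv => ?_
      have : (⟨v, hv⟩ : V) ∈ W p := by rw [hpt]; trivial
      exact this
    have : r ∈ ⋃ p ∈ associatedPrimes S M, (p : Set S) := Set.mem_biUnion hp (hVp hr)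
    rw [hU] at this
    exact this hreg
  have hne := Subspace.biUnion_ne_univ_of_top_notMem htop
  obtain ⟨v, hv⟩ := (Set.ne_univ_iff_exists_notMem _).1 hne
  refine ⟨v, v.2, ?_⟩
  by_contra hnr
  have : (v : S) ∈ ⋃ p ∈ associatedPrimes S M, (p : Set S) := by rw [hU]; exact hnr
  obtain ⟨p, hp, hvp⟩ := Set.mem_iUnion₂.1 this
  exact hv (Set.mem_biUnion (Finset.mem_coe.2 (Finset.mem_image.2
    ⟨p, hfin.mem_toFinset.2 hp, rfl⟩)) hvp)

/-- Rees's characterization of grade, with the elements chosen in `V`. Vanishing of `Ext⁰` yields a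
nonzerodivisor `x`, and the long exact sequence of multiplication by `x` transfers the vanishing to
`M / xM` in one degree fewer. -/
theorem exists_isWeaklyRegular_of_subsingleton_ext (V : Submodule L S) (m : ℕ)
    (M : ModuleCat.{u} S) [Module.Finite S M]
    (hext : ∀ i < m, Subsingleton (Ext (ModuleCat.of S (S ⧸ Ideal.span (V : Set S))) M i)) :
    ∃ rs : List S, rs.length = m ∧ (∀ r ∈ rs, r ∈ V) ∧ IsWeaklyRegular M rs := by
  induction m generalizing M with
  | zero => exact ⟨[], rfl, by simp, IsWeaklyRegular.nil _ _⟩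
  | succ m ih =>
    have h0 : Subsingleton (ModuleCat.of S (S ⧸ Ideal.span (V : Set S)) ⟶ M) :=
      Ext.addEquiv₀.subsingleton_congr.mp (hext 0 m.zero_lt_succ)
    have h1 : Subsingleton ((S ⧸ Ideal.span (V : Set S)) →ₗ[S] M) :=
      (ModuleCat.homAddEquiv (M := ModuleCat.of S (S ⧸ Ideal.span (V : Set S)))
        (N := M)).symm.subsingleton
    obtain ⟨r, hr, hreg⟩ := IsSMulRegular.subsingleton_linearMap_iff.mp h1
    rw [Ideal.annihilator_quotient] at hr
    obtain ⟨x, hxV, hx⟩ := exists_isSMulRegular_mem_submodule V hr hreg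
    obtain ⟨rs, hlen, hmem, hrs⟩ := ih (ModuleCat.of S (QuotSMulTop x M)) fun i hi => by
      have zero1 := AddCommGrpCat.isZero_of_iff_subsingleton.mpr (hext i (by omega))
      have zero2 := AddCommGrpCat.isZero_of_iff_subsingleton.mpr (hext (i + 1) (by omega))
      exact AddCommGrpCat.subsingleton_of_isZero <| ShortComplex.Exact.isZero_of_both_zeros
        ((Ext.covariant_sequence_exact₃' _ hx.smulShortComplex_shortExact) i (i + 1) rfl)
        (zero1.eq_zero_of_src _) (zero2.eq_zero_of_tgt _)
    exact ⟨x :: rs, by simp [hlen], by simpa [hxV] using hmem, IsWeaklyRegular.cons hx hrs⟩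

/-- If `rs` is a regular sequence in the radical of the ideal generated by `V`, then there are as
long weakly regular sequences in `V`. -/
theorem exists_isWeaklyRegular_of_radical (V : Submodule L S) (rs : List S)
    (hrs : IsRegular S rs) (hrad : ∀ r ∈ rs, r ∈ (Ideal.span (V : Set S)).radical) :
    ∃ gs : List S, gs.length = rs.length ∧ (∀ g ∈ gs, g ∈ V) ∧ IsWeaklyRegular S gs := by
  refine exists_isWeaklyRegular_of_subsingleton_ext V rs.length (ModuleCat.of S S) ?_
  -- The radical hypothesis places the support of `S / (V)` inside the zero locus of `rs`, which
  -- makes these `Ext` groups vanish.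
  refine ModuleCat.subsingleton_ext_of_exists_isRegular (Ideal.ofList rs) _ ?_ _ ?_ rs ?_ hrs
  · rw [Module.support_eq_zeroLocus, PrimeSpectrum.zeroLocus_subset_zeroLocus_iff]
    change _ ≤ (Module.annihilator S (S ⧸ Ideal.span (V : Set S))).radical
    rw [Ideal.annihilator_quotient]
    exact Ideal.span_le.2 hrad
  · exact (Ne.symm hrs.top_ne_smul).lt_top
  · exact fun r hr => Ideal.subset_span hr

end Rees

/-- Each `g i` is a nonzerodivisor modulo the previous ones. -/
def RegularSeq {S : Type*} [CommRing S] {m : ℕ} (g : Fin m → S) : Prop :=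
  ∀ i u, u * g i ∈ Ideal.span (g '' Set.Iio i) → u ∈ Ideal.span (g '' Set.Iio i)

/-! ### Syzygies of regular sequences. -/

section RegularSeq

variable {S : Type*} [CommRing S]

theorem isWeaklyRegular_iff_regularSeq (rs : List S) :
    RingTheory.Sequence.IsWeaklyRegular S rs ↔ RegularSeq rs.get := by
  rw [RingTheory.Sequence.isWeaklyRegular_iff_Fin]
  refine forall_congr' fun i => ?_
  have h : (Ideal.ofList (rs.take i) • ⊤ : Submodule S S) = Ideal.span (rs.get '' Set.Iio i) := by
    rw [smul_eq_mul, Ideal.mul_top]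
    refine congrArg Ideal.span (Set.ext fun x => ?_)
    constructor
    · intro hx
      obtain ⟨j, hj, hjx⟩ := List.mem_take_iff_getElem.1 hx
      refine ⟨⟨j, by omega⟩, ?_, hjx⟩
      simp only [Set.mem_Iio, Fin.lt_def]
      omega
    · rintro ⟨j, hj, rfl⟩
      exact List.mem_take_iff_getElem.2 ⟨j, by simp only [Set.mem_Iio, Fin.lt_def] at hj; omega, rfl⟩
  rw [h, isSMulRegular_quotient_iff_mem_of_smul_mem]
  refine forall_congr' fun u => ?_
  rw [smul_eq_mul, mul_comm]
  rfl

/-- In a relation, regularity writes the last coefficient as a combination `∑ c_i g_i` of the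
earlier elements. Substituting it leaves a relation between the earlier elements alone. -/
theorem RegularSeq.trivialSyzygies {m : ℕ} {g : Fin m → S} (hg : RegularSeq g) :
    TrivialSyzygies g := by
  induction m with
  | zero => exact fun b _ => ⟨fun i => i.elim0, fun i => i.elim0, fun i => i.elim0⟩
  | succ m ih =>
    have himg : ∀ i : Fin m, (fun j : Fin m => g j.castSucc) '' Set.Iio i =
        g '' Set.Iio i.castSucc := by
      intro i
      ext x
      constructor
      · rintro ⟨j, hj, rfl⟩
        exact ⟨j.castSucc, by simpa using hj, rfl⟩
      · rintro ⟨j, hj, rfl⟩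
        have hj' : (j : ℕ) < i := hj
        exact ⟨⟨j, by omega⟩, hj', rfl⟩
    have hlast : g '' Set.Iio (Fin.last m) = Set.range fun j : Fin m => g j.castSucc := by
      ext x
      constructor
      · rintro ⟨j, hj, rfl⟩
        have hj' : (j : ℕ) < m := hj
        exact ⟨⟨j, hj'⟩, rfl⟩
      · rintro ⟨j, rfl⟩
        exact ⟨j.castSucc, Fin.castSucc_lt_last j, rfl⟩
    have hg' : RegularSeq fun j : Fin m => g j.castSucc := by
      intro i u hu
      rw [himg] at hu ⊢
      exact hg _ u hu
    intro b hb
    rw [Fin.sum_univ_castSucc] at hb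
    have hmem : b (Fin.last m) * g (Fin.last m) ∈ Ideal.span (g '' Set.Iio (Fin.last m)) := by
      rw [hlast, Ideal.mem_span_range_iff_exists_fun]
      exact ⟨fun i => -b i.castSucc, by
        simp only [neg_mul, Finset.sum_neg_distrib]; linear_combination -hb⟩
    have h1 := hg _ _ hmem
    rw [hlast, Ideal.mem_span_range_iff_exists_fun] at h1
    obtain ⟨c, hc⟩ := h1
    obtain ⟨s, hs2, hs3⟩ := ih hg' (fun i => b i.castSucc + c i * g (Fin.last m)) (by
      simp only [add_mul, Finset.sum_add_distrib]
      have : ∑ i, c i * g (Fin.last m) * g i.castSucc =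
          (∑ i, c i * g i.castSucc) * g (Fin.last m) := by
        rw [Finset.sum_mul]; exact Finset.sum_congr rfl fun i _ => by ring
      rw [this, hc, hb])
    -- The antisymmetric matrix `s` of the shorter relation, bordered by the row `c` and the column
    -- `-c`.
    let t : Fin (m + 1) → Fin (m + 1) → S :=
      Fin.lastCases (Fin.lastCases 0 c)
        fun i => Fin.lastCases (-c i) (s i)
    have t1 : t (Fin.last m) (Fin.last m) = 0 := by simp [t]
    have t2 : ∀ i : Fin m, t (Fin.last m) i.castSucc = c i := by simp [t]
    have t3 : ∀ i : Fin m, t i.castSucc (Fin.last m) = -c i := by simp [t]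
    have t4 : ∀ i j : Fin m, t i.castSucc j.castSucc = s i j := by simp [t]
    refine ⟨t, fun i j => ?_, fun i => ?_⟩
    · refine Fin.lastCases ?_ (fun i => ?_) i <;> refine Fin.lastCases ?_ (fun j => ?_) j
      · rw [t1, neg_zero]
      · rw [t2, t3, neg_neg]
      · rw [t2, t3]
      · rw [t4, t4, hs2]
    · refine Fin.lastCases ?_ (fun i => ?_) i
      · rw [Fin.sum_univ_castSucc, t1, zero_mul, add_zero, ← hc]
        simp only [t2]
      · rw [Fin.sum_univ_castSucc, t3]
        simp only [t4]
        linear_combination hs3 i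

/-- A syzygy of `f` becomes one of `g`, with antisymmetric matrix `s`; going back replaces `s` by
`Bᵀ s B`, still antisymmetric. -/
theorem TrivialSyzygies.change {ι : Type*} [Fintype ι] [DecidableEq ι] {f g : ι → S}
    (hg : TrivialSyzygies g)
    {A B : Matrix ι ι S} (hAB : A * B = 1) (hf : ∀ j, f j = ∑ k, A j k * g k)
    (hgf : ∀ k, g k = ∑ j, B k j * f j) : TrivialSyzygies f := by
  intro b hb
  obtain ⟨s, hs2, hs3⟩ := hg (fun k => ∑ j, b j * A j k) (by
    rw [← hb]
    simp only [hf, Finset.sum_mul, Finset.mul_sum]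
    rw [Finset.sum_comm]
    exact Finset.sum_congr rfl fun j _ => Finset.sum_congr rfl fun k _ => by ring)
  have key : ∀ i, b i = ∑ j, (∑ k, ∑ l, B k i * s k l * B l j) * f j := by
    intro i
    have h1 : b i = ∑ k, (∑ j, b j * A j k) * B k i := by
      have : ∀ j, ∑ k, A j k * B k i = if j = i then 1 else 0 := fun j => by
        rw [← Matrix.mul_apply, hAB, Matrix.one_apply]
      simp only [Finset.sum_mul]
      rw [Finset.sum_comm]
      simp only [mul_assoc, ← Finset.mul_sum, this]
      simp
    have h2 : ∀ k l, s k l * g l * B k i = ∑ j, B k i * s k l * B l j * f j := by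
      intro k l
      rw [hgf l, Finset.mul_sum, Finset.sum_mul]
      exact Finset.sum_congr rfl fun j _ => by ring
    rw [h1]
    simp only [hs3, Finset.sum_mul, h2]
    conv_rhs => rw [Finset.sum_comm]
    refine Finset.sum_congr rfl fun k _ => ?_
    rw [Finset.sum_comm]
  have hanti : ∀ i j, ∑ k, ∑ l, B k i * s k l * B l j = -∑ k, ∑ l, B k j * s k l * B l i := by
    intro i j
    conv_lhs => rw [Finset.sum_comm]
    rw [← Finset.sum_neg_distrib]
    refine Finset.sum_congr rfl fun k _ => ?_
    rw [← Finset.sum_neg_distrib]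
    refine Finset.sum_congr rfl fun l _ => ?_
    rw [hs2 l k]
    ring
  refine ⟨fun i j => ∑ k, ∑ l, B k i * s k l * B l j, hanti, key⟩

/-- If `1 = ∑ c_j f_j`, the matrix `b_i c_j - b_j c_i` works. -/
theorem trivialSyzygies_of_span_eq_top {ι : Type*} [Fintype ι] {f : ι → S}
    (h : Ideal.span (Set.range f) = ⊤) : TrivialSyzygies f := by
  intro b hb
  obtain ⟨c, hc⟩ := Ideal.mem_span_range_iff_exists_fun.1 (h ▸ Submodule.mem_top (x := (1 : S)))
  refine ⟨fun i j => b i * c j - b j * c i, fun i j => by ring, fun i => ?_⟩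
  simp only [sub_mul, Finset.sum_sub_distrib]
  have h1 : ∑ j, b i * c j * f j = b i * ∑ j, c j * f j := by
    rw [Finset.mul_sum]; exact Finset.sum_congr rfl fun j _ => by ring
  have h2 : ∑ j, b j * c i * f j = c i * ∑ j, b j * f j := by
    rw [Finset.mul_sum]; exact Finset.sum_congr rfl fun j _ => by ring
  rw [h1, h2, hc, hb]
  ring

end RegularSeq

/-! ### The variables form a regular sequence -/

/-- Ideals generated by variables are monomial, so membership is read off the support, and
multiplying by another variable does not affect it. This sequence feeds
`exists_isWeaklyRegular_of_radical`. -/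
theorem isRegular_X (L : Type*) [Field L] (m : ℕ) :
    RingTheory.Sequence.IsRegular (MvPolynomial (Fin m) L)
      (List.ofFn (X : Fin m → MvPolynomial (Fin m) L)) := by
  refine ⟨?_, fun h => ?_⟩
  · rw [isWeaklyRegular_iff_regularSeq]
    intro i u hu
    have himg : (List.ofFn (X : Fin m → MvPolynomial (Fin m) L)).get '' Set.Iio i =
        X '' {j : Fin m | (j : ℕ) < i} := by
      ext x
      constructor
      · rintro ⟨j, hj, rfl⟩
        exact ⟨⟨j, by simpa using j.2⟩, by simpa using hj, by simp⟩
      · rintro ⟨j, hj, rfl⟩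
        exact ⟨⟨j, by simp⟩, hj, by simp⟩
    rw [himg, mem_ideal_span_X_image] at hu ⊢
    intro w hw
    have hi : (i : ℕ) < m := by simpa using i.2
    have hget : (List.ofFn (X : Fin m → MvPolynomial (Fin m) L)).get i = X ⟨i, hi⟩ := by simp
    rw [hget] at hu
    obtain ⟨j, hj, hne⟩ := hu (w + Finsupp.single ⟨i, hi⟩ 1) (by
      rw [mem_support_iff, coeff_mul_X]
      exact mem_support_iff.1 hw)
    refine ⟨j, hj, ?_⟩
    have : j ≠ ⟨i, hi⟩ := by
      rintro rfl
      simp at hj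
    rwa [Finsupp.add_apply, Finsupp.single_apply, if_neg (Ne.symm this), add_zero] at hne
  · rw [smul_eq_mul, Ideal.mul_top] at h
    have h1 : (1 : MvPolynomial (Fin m) L) ∈
        Ideal.ofList (List.ofFn (X : Fin m → MvPolynomial (Fin m) L)) := h ▸ Submodule.mem_top
    have h2 : Ideal.ofList (List.ofFn (X : Fin m → MvPolynomial (Fin m) L)) =
        Ideal.span (X '' Set.univ) := by
      unfold Ideal.ofList
      congr 1
      ext x
      simp [List.mem_ofFn]
    rw [h2, mem_ideal_span_X_image] at h1
    obtain ⟨j, -, hj⟩ := h1 0 (by simp)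
    exact hj rfl

end Telescoping

namespace Telescoping

open MvPolynomial

/-! ### Complete intersections in polynomial rings -/

section CompleteIntersection

instance finite_homZ {σ L : Type*} [Field L] [Finite σ] (D : ℤ) : Module.Finite L (homZ σ L D) := by
  by_cases hD : D < 0
  · have : homZ σ L D = ⊥ := (Submodule.eq_bot_iff _).2 fun x hx => homZ_neg hD hx
    rw [this]
    infer_instance
  · obtain ⟨e, rfl⟩ := Int.eq_ofNat_of_zero_le (not_lt.1 hD)
    rw [Module.Finite.iff_fg, homZ_natCast]
    exact homogeneousSubmodule_fg σ L e

variable {L : Type*} [Field L] {m : ℕ}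

/-- The part of degree `D` of an ideal. -/
noncomputable def degPart (T : Ideal (MvPolynomial (Fin m) L)) (D : ℤ) : Submodule L (MvPolynomial (Fin m) L) :=
  T.restrictScalars L ⊓ homZ (Fin m) L D

instance (T : Ideal (MvPolynomial (Fin m) L)) (D : ℤ) : Module.Finite L (degPart T D) :=
  Submodule.finiteDimensional_inf_right _ _

theorem homComp_mem_span {A : Set (MvPolynomial (Fin m) L)} {e : ℤ} (hA : ∀ a ∈ A, a ∈ homZ (Fin m) L e) {x : MvPolynomial (Fin m) L}
    (hx : x ∈ Ideal.span A) (D : ℤ) : homComp D x ∈ Ideal.span A := by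
  obtain ⟨k, c, a, rfl⟩ := Submodule.mem_span_set'.1 hx
  rw [map_sum]
  refine Ideal.sum_mem _ fun i _ => ?_
  rw [smul_eq_mul, homComp_mul (D := D - e) (hA _ (a i).2) (by ring)]
  exact Ideal.mul_mem_left _ _ (Ideal.subset_span (a i).2)

/-- Multiplication by `g` embeds degree `D - e` into degree `D`, and by regularity its image meets
`T` exactly in the image of `T`. The identity is the dimension formula for a sum and an
intersection. -/
theorem finrank_degPart_sup {T : Ideal (MvPolynomial (Fin m) L)} (hT : ∀ x ∈ T, ∀ D, homComp D x ∈ T) {e : ℤ} {g : MvPolynomial (Fin m) L}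
    (hg : g ∈ homZ (Fin m) L e) (hg0 : g ≠ 0) (hreg : ∀ u, u * g ∈ T → u ∈ T) (D : ℤ) :
    Module.finrank L (degPart (T ⊔ Ideal.span {g}) D) + Module.finrank L (degPart T (D - e)) =
      Module.finrank L (degPart T D) + Module.finrank L (homZ (Fin m) L (D - e)) := by
  have hinj : Function.Injective (LinearMap.mulRight L g) := fun x y h =>
    mul_right_cancel₀ hg0 h
  have hsup : degPart T D ⊔ (homZ (Fin m) L (D - e)).map (LinearMap.mulRight L g) =
      degPart (T ⊔ Ideal.span {g}) D := by
    apply le_antisymm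
    · refine sup_le (fun x hx => ⟨Ideal.mem_sup_left hx.1, hx.2⟩) ?_
      rintro _ ⟨v, hv, rfl⟩
      exact ⟨Ideal.mem_sup_right (Ideal.mul_mem_left _ _ (Ideal.mem_span_singleton_self g)),
        mul_mem_homZ hv hg (by ring)⟩
    · rintro x ⟨hx1, hx2⟩
      obtain ⟨t, ht, y, hy, rfl⟩ := Submodule.mem_sup.1 hx1
      obtain ⟨v, rfl⟩ := Ideal.mem_span_singleton'.1 hy
      rw [← homComp_of_mem hx2, map_add, homComp_mul (D := D - e) hg (by ring)]
      exact Submodule.add_mem_sup ⟨hT t ht D, homComp_mem _ _⟩ ⟨_, homComp_mem _ _, rfl⟩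
  have hinf : degPart T D ⊓ (homZ (Fin m) L (D - e)).map (LinearMap.mulRight L g) =
      (degPart T (D - e)).map (LinearMap.mulRight L g) := by
    apply le_antisymm
    · rintro x ⟨⟨hx1, -⟩, v, hv, rfl⟩
      exact ⟨v, ⟨hreg v hx1, hv⟩, rfl⟩
    · rintro _ ⟨v, ⟨hv1, hv2⟩, rfl⟩
      exact ⟨⟨Ideal.mul_mem_right _ _ hv1, mul_mem_homZ hv2 hg (by ring)⟩, v, hv2, rfl⟩
  have h := Submodule.finrank_sup_add_finrank_inf_eq (degPart T D)
    ((homZ (Fin m) L (D - e)).map (LinearMap.mulRight L g))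
  rwa [hsup, hinf, ← (Submodule.equivMapOfInjective _ hinj _).finrank_eq,
    ← (Submodule.equivMapOfInjective _ hinj _).finrank_eq] at h

/-- The Hilbert function of a homogeneous regular sequence only depends on the degrees. -/
theorem RegularSeq.finrank_degPart_eq {e : ℤ} {g g' : Fin m → MvPolynomial (Fin m) L} (hg : RegularSeq g)
    (hg' : RegularSeq g') (hge : ∀ i, g i ∈ homZ (Fin m) L e)
    (hge' : ∀ i, g' i ∈ homZ (Fin m) L e) (h0 : ∀ i, g i ≠ 0) (h0' : ∀ i, g' i ≠ 0) (D : ℤ) :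
    Module.finrank L (degPart (Ideal.span (Set.range g)) D) =
      Module.finrank L (degPart (Ideal.span (Set.range g')) D) := by
  have himg : ∀ (g : Fin m → MvPolynomial (Fin m) L) (i : ℕ) (hi : i < m),
      Ideal.span (g '' {j : Fin m | (j : ℕ) < i + 1}) =
        Ideal.span (g '' Set.Iio ⟨i, hi⟩) ⊔ Ideal.span {g ⟨i, hi⟩} := by
    intro g i hi
    rw [← Ideal.span_union]
    congr 1
    ext x
    constructor
    · rintro ⟨j, hj, rfl⟩
      rcases Nat.lt_succ_iff_lt_or_eq.1 hj with h | h
      · exact Or.inl ⟨j, h, rfl⟩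
      · exact Or.inr (by rw [Set.mem_singleton_iff]; congr 1; exact Fin.ext h)
    · rintro (⟨j, hj, rfl⟩ | rfl)
      · exact ⟨j, Nat.lt_succ_of_lt hj, rfl⟩
      · exact ⟨⟨i, hi⟩, Nat.lt_succ_self i, rfl⟩
  have hhom : ∀ (g : Fin m → MvPolynomial (Fin m) L), (∀ i, g i ∈ homZ (Fin m) L e) → ∀ s : Set (Fin m),
      ∀ x ∈ Ideal.span (g '' s), ∀ D, homComp D x ∈ Ideal.span (g '' s) := by
    intro g hg s x hx D
    refine homComp_mem_span (e := e) ?_ hx D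
    rintro _ ⟨i, -, rfl⟩
    exact hg i
  have key : ∀ i ≤ m, ∀ D, Module.finrank L (degPart (Ideal.span (g '' {j | (j : ℕ) < i})) D) =
      Module.finrank L (degPart (Ideal.span (g' '' {j | (j : ℕ) < i})) D) := by
    intro i
    induction i with
    | zero =>
      intro _ D
      have : {j : Fin m | (j : ℕ) < 0} = ∅ := by ext j; simp
      rw [this, Set.image_empty, Set.image_empty]
    | succ i ih =>
      intro hi D
      have hi' : i < m := hi
      rw [himg g i hi', himg g' i hi']
      have e1 := finrank_degPart_sup (hhom g hge (Set.Iio ⟨i, hi'⟩)) (hge ⟨i, hi'⟩)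
        (h0 ⟨i, hi'⟩) (hg ⟨i, hi'⟩) D
      have e2 := finrank_degPart_sup (hhom g' hge' (Set.Iio ⟨i, hi'⟩)) (hge' ⟨i, hi'⟩)
        (h0' ⟨i, hi'⟩) (hg' ⟨i, hi'⟩) D
      have e3 := ih (by omega) D
      have e4 := ih (by omega) (D - e)
      change Module.finrank L (degPart (Ideal.span (g '' Set.Iio ⟨i, hi'⟩)) D) =
        Module.finrank L (degPart (Ideal.span (g' '' Set.Iio ⟨i, hi'⟩)) D) at e3
      change Module.finrank L (degPart (Ideal.span (g '' Set.Iio ⟨i, hi'⟩)) (D - e)) =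
        Module.finrank L (degPart (Ideal.span (g' '' Set.Iio ⟨i, hi'⟩)) (D - e)) at e4
      omega
  have hm : ∀ g : Fin m → MvPolynomial (Fin m) L, g '' {j | (j : ℕ) < m} = Set.range g := by
    intro g
    rw [← Set.image_univ]
    congr 1
    ext j
    simp
  have := key m le_rfl D
  rwa [hm, hm] at this

/-- The last nonzero coefficient of a relation is a constant which multiplies some `g i` into the
ideal of the earlier elements; regularity then puts this unit in the ideal. -/
theorem RegularSeq.linearIndependent {g : Fin m → MvPolynomial (Fin m) L} (hg : RegularSeq g)
    (hne : Ideal.span (Set.range g) ≠ ⊤) : LinearIndependent L g := by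
  classical
  rw [Fintype.linearIndependent_iff]
  intro c hc
  by_contra! hex
  obtain ⟨i0, hi0⟩ := hex
  have hs : (Finset.univ.filter fun i => c i ≠ 0).Nonempty := ⟨i0, by simpa using hi0⟩
  set i := (Finset.univ.filter fun i => c i ≠ 0).max' hs with hi
  have hci : c i ≠ 0 := by
    have := Finset.max'_mem _ hs
    rw [← hi] at this
    simpa using this
  have hzero : ∀ j, i < j → c j = 0 := by
    intro j hj
    by_contra h
    exact absurd (Finset.le_max' (Finset.univ.filter fun i => c i ≠ 0) j (by simpa using h))
      (not_le.2 hj)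
  have hmem : (C (c i) : MvPolynomial (Fin m) L) * g i ∈ Ideal.span (g '' Set.Iio i) := by
    have h1 := Finset.add_sum_erase Finset.univ (fun j => c j • g j) (Finset.mem_univ i)
    rw [hc] at h1
    have h2 : (C (c i) : MvPolynomial (Fin m) L) * g i = -∑ j ∈ Finset.univ.erase i, c j • g j := by
      rw [C_mul']; linear_combination h1
    rw [h2]
    refine Ideal.neg_mem_iff _ |>.2 (Ideal.sum_mem _ fun j hj => ?_)
    have hji := (Finset.mem_erase.1 hj).1
    rcases lt_or_gt_of_ne hji with h | h
    · rw [← C_mul']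
      exact Ideal.mul_mem_left _ _ (Ideal.subset_span ⟨j, h, rfl⟩)
    · rw [hzero j h, zero_smul]
      exact Ideal.zero_mem _
  have h3 := Ideal.span_mono (Set.image_subset_range _ _) (hg i _ hmem)
  exact hne (Ideal.eq_top_of_isUnit_mem _ h3 ((isUnit_iff_ne_zero.2 hci).map C))

/-- The span `V` of the `F i` has dimension at most `m` and contains a regular sequence of length
`m`, which is linearly independent. Both families are therefore bases of `V`. -/
theorem exists_regularSeq [Infinite L] {F : Fin m → MvPolynomial (Fin m) L} (hrad : ∀ i, X i ∈ (Ideal.span (Set.range F)).radical)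
    (hne : Ideal.span (Set.range F) ≠ ⊤) :
    ∃ (g : Fin m → MvPolynomial (Fin m) L) (A B : Matrix (Fin m) (Fin m) L), RegularSeq g ∧ LinearIndependent L g ∧
      A * B = 1 ∧ (∀ j, F j = ∑ k, C (A j k) * g k) ∧ (∀ k, g k = ∑ j, C (B k j) * F j) := by
  classical
  set V : Submodule L (MvPolynomial (Fin m) L) := Submodule.span L (Set.range F) with hV
  have hVspan : Ideal.span (V : Set (MvPolynomial (Fin m) L)) = Ideal.span (Set.range F) := by
    apply le_antisymm
    · refine Ideal.span_le.2 ?_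
      change V ≤ (Ideal.span (Set.range F)).restrictScalars L
      exact Submodule.span_le.2 Ideal.subset_span
    · exact Ideal.span_mono Submodule.subset_span
  obtain ⟨gs, hlen, hgV, hgs⟩ := exists_isWeaklyRegular_of_radical V _ (isRegular_X L m) (by
    intro r hr
    rw [hVspan]
    obtain ⟨i, rfl⟩ := List.mem_ofFn.1 hr
    exact hrad i)
  rw [List.length_ofFn] at hlen
  obtain ⟨g, hgV, hg⟩ : ∃ g : Fin m → MvPolynomial (Fin m) L, (∀ i, g i ∈ V) ∧ RegularSeq g := by
    rw [isWeaklyRegular_iff_regularSeq] at hgs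
    have : ∀ (S : Type _) [CommRing S] (k : ℕ) (gs : List S), gs.length = k → RegularSeq gs.get →
        ∃ g : Fin k → S, (∀ i, g i ∈ gs) ∧ RegularSeq g := by
      intro S _ k gs hk h
      subst hk
      exact ⟨gs.get, fun i => List.get_mem _ _, h⟩
    obtain ⟨g, h1, h2⟩ := this _ m gs hlen hgs
    exact ⟨g, fun i => hgV _ (h1 i), h2⟩
  have hgne : Ideal.span (Set.range g) ≠ ⊤ := by
    intro h
    refine hne (top_le_iff.1 (h ▸ Ideal.span_le.2 ?_))
    rintro _ ⟨i, rfl⟩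
    rw [← hVspan]
    exact Ideal.subset_span (hgV i)
  have hgli := hg.linearIndependent hgne
  have hfinV : Module.Finite L V := Module.Finite.span_of_finite L (Set.finite_range F)
  have hle : Submodule.span L (Set.range g) ≤ V := Submodule.span_le.2 (by
    rintro _ ⟨i, rfl⟩; exact hgV i)
  have hrk : Module.finrank L (Submodule.span L (Set.range g)) = m := by
    rw [finrank_span_eq_card hgli, Fintype.card_fin]
  have hVle : Module.finrank L V ≤ m := by
    have := finrank_range_le_card (R := L) F
    rwa [Fintype.card_fin] at this
  have heq : Submodule.span L (Set.range g) = V :=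
    Submodule.eq_of_le_of_finrank_le hle (by rw [hrk]; exact hVle)
  have hFli : LinearIndependent L F := by
    rw [linearIndependent_iff_card_eq_finrank_span, Fintype.card_fin]
    change m = Module.finrank L V
    rw [← heq, hrk]
  have hA : ∀ j, ∃ a : Fin m → L, ∑ k, a k • g k = F j := fun j =>
    (Submodule.mem_span_range_iff_exists_fun L).1 (heq ▸ Submodule.subset_span ⟨j, rfl⟩)
  have hB : ∀ k, ∃ b : Fin m → L, ∑ j, b j • F j = g k := fun k =>
    (Submodule.mem_span_range_iff_exists_fun L).1 (hgV k)
  choose A hA using hA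
  choose B hB using hB
  refine ⟨g, A, B, hg, hgli, ?_, fun j => by simp only [C_mul', hA], fun k => by
    simp only [C_mul', hB]⟩
  ext j i
  let A' : Matrix (Fin m) (Fin m) L := A
  let B' : Matrix (Fin m) (Fin m) L := B
  have h1 : ∑ i, (A' * B') j i • F i = F j := by
    rw [← hA j]
    simp only [← hB, Finset.smul_sum, smul_smul, Matrix.mul_apply, Finset.sum_smul]
    rw [Finset.sum_comm]
  have h2 : ∑ i, ((A' * B') j i - (1 : Matrix (Fin m) (Fin m) L) j i) • F i = 0 := by
    simp only [sub_smul, Finset.sum_sub_distrib, h1, Matrix.one_apply, ite_smul, one_smul,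
      zero_smul]
    simp
  exact sub_eq_zero.1 (Fintype.linearIndependent_iff.1 hFli _ h2 i)

theorem trivialSyzygies_of_radical [Infinite L] {F : Fin m → MvPolynomial (Fin m) L}
    (hrad : ∀ i, X i ∈ (Ideal.span (Set.range F)).radical) : TrivialSyzygies F := by
  classical
  -- The unit ideal does occur, for instance for the constant derivatives of a nonzero linear form.
  by_cases hne : Ideal.span (Set.range F) = ⊤
  · exact trivialSyzygies_of_span_eq_top hne
  obtain ⟨g, A, B, hg, -, hAB, hF, hgF⟩ := exists_regularSeq hrad hne
  refine hg.trivialSyzygies.change (A := A.map C) (B := B.map C) ?_ hF hgF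
  have := congrArg (fun M : Matrix (Fin m) (Fin m) L => M.map (C : L →+* MvPolynomial (Fin m) L)) hAB
  simp only [Matrix.map_mul] at this
  rw [this, Matrix.map_one _ (map_zero _) (map_one _)]

/-- Pigeonhole: some exponent of a monomial of degree at least `m e` is at least `e`. -/
theorem homZ_le_span_X_pow (hm : 0 < m) (e : ℕ) {D : ℤ} (hD : (m : ℤ) * e ≤ D) :
    ∀ u ∈ homZ (Fin m) L D, u ∈ Ideal.span (Set.range fun i : Fin m => (X i : MvPolynomial (Fin m) L) ^ e) := by
  intro u hu
  rw [as_sum u]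
  refine Ideal.sum_mem _ fun w hw => ?_
  have hdeg := hu w (mem_support_iff.1 hw)
  obtain ⟨i, hi⟩ : ∃ i, e ≤ w i := by
    by_contra! h
    have h1 : w.degree = ∑ i, w i := Finsupp.degree_eq_sum w
    have h2 : ∑ i, w i < ∑ _i : Fin m, e :=
      Finset.sum_lt_sum_of_nonempty ⟨⟨0, hm⟩, Finset.mem_univ _⟩ fun i _ => h i
    simp only [Finset.sum_const, Finset.card_univ, Fintype.card_fin, smul_eq_mul] at h2
    rw [← h1] at h2
    have : (w.degree : ℤ) < m * e := by exact_mod_cast h2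
    omega
  have hfac : monomial w (u.coeff w) =
      monomial (w - Finsupp.single i e) (u.coeff w) * (X i : MvPolynomial (Fin m) L) ^ e := by
    rw [X_pow_eq_monomial, monomial_mul, mul_one, tsub_add_cancel_of_le]
    exact Finsupp.single_le_iff.2 hi
  rw [hfac]
  exact Ideal.mul_mem_left _ _ (Ideal.subset_span ⟨i, rfl⟩)

/-- `m` forms of degree `e` in `m` variables without nontrivial common zeros generate all the forms
of degree at least `m e`. -/
theorem homZ_le_span_of_radical [Infinite L] (hm : 0 < m) {e : ℕ} {F : Fin m → MvPolynomial (Fin m) L}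
    (hF : ∀ i, F i ∈ homZ (Fin m) L e)
    (hrad : ∀ i, X i ∈ (Ideal.span (Set.range F)).radical) {D : ℤ} (hD : (m : ℤ) * e ≤ D)
    {u : MvPolynomial (Fin m) L} (hu : u ∈ homZ (Fin m) L D) : u ∈ Ideal.span (Set.range F) := by
  by_cases hne : Ideal.span (Set.range F) = ⊤
  · rw [hne]; trivial
  have hlin : ∀ {F : Fin m → MvPolynomial (Fin m) L} {A B : Matrix (Fin m) (Fin m) L} {g : Fin m → MvPolynomial (Fin m) L},
      (∀ j, F j = ∑ k, C (A j k) * g k) → (∀ k, g k = ∑ j, C (B k j) * F j) →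
      Ideal.span (Set.range F) = Ideal.span (Set.range g) := by
    intro F A B g h1 h2
    apply le_antisymm <;> refine Ideal.span_le.2 ?_ <;> rintro _ ⟨i, rfl⟩
    · rw [h1]
      exact Ideal.sum_mem _ fun k _ => Ideal.mul_mem_left _ _ (Ideal.subset_span ⟨k, rfl⟩)
    · rw [h2]
      exact Ideal.sum_mem _ fun k _ => Ideal.mul_mem_left _ _ (Ideal.subset_span ⟨k, rfl⟩)
  have hdeg : ∀ {F : Fin m → MvPolynomial (Fin m) L} {B : Matrix (Fin m) (Fin m) L} {g : Fin m → MvPolynomial (Fin m) L},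
      (∀ i, F i ∈ homZ (Fin m) L e) → (∀ k, g k = ∑ j, C (B k j) * F j) →
      ∀ k, g k ∈ homZ (Fin m) L e := by
    intro F B g h1 h2 k
    rw [h2]
    exact Submodule.sum_mem _ fun j _ => mul_mem_homZ (C_mem_homZ _) (h1 j) (by ring)
  -- Forms of degree `0` are constants: they generate either the zero ideal, whose radical contains
  -- no variable, or the unit ideal, excluded here.
  have he : e ≠ 0 := by
    rintro rfl
    obtain ⟨k, hk⟩ := hrad ⟨0, hm⟩
    refine hne ((Ideal.eq_top_iff_one _).2 ?_)
    by_cases h0 : ∀ i, F i = 0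
    · have : Ideal.span (Set.range F) = ⊥ := by
        rw [Ideal.span_eq_bot]
        rintro _ ⟨i, rfl⟩
        exact h0 i
      rw [this] at hk
      exact absurd ((Submodule.mem_bot _).1 hk) (pow_ne_zero _ (X_ne_zero _))
    · push Not at h0
      obtain ⟨i, hi⟩ := h0
      have h1 : F i = C (coeff 0 (F i)) := by
        have := hF i
        rw [homZ_natCast, mem_homogeneousSubmodule, ← totalDegree_zero_iff_isHomogeneous,
          totalDegree_eq_zero_iff_eq_C] at this
        exact this
      have h2 : coeff 0 (F i) ≠ 0 := fun h => hi (by rw [h1, h, map_zero])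
      have h3 : C (coeff 0 (F i))⁻¹ * F i = 1 := by
        nth_rewrite 2 [h1]
        rw [← map_mul, inv_mul_cancel₀ h2, map_one]
      rw [← h3]
      exact Ideal.mul_mem_left _ _ (Ideal.subset_span ⟨i, rfl⟩)
  have hXne : Ideal.span (Set.range fun i : Fin m => (X i : MvPolynomial (Fin m) L) ^ e) ≠ ⊤ := by
    intro h
    have h1 : Ideal.span (Set.range fun i : Fin m => (X i : MvPolynomial (Fin m) L) ^ e) ≤
        RingHom.ker (constantCoeff : MvPolynomial (Fin m) L →+* L) := by
      refine Ideal.span_le.2 ?_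
      rintro _ ⟨i, rfl⟩
      simp [RingHom.mem_ker, he]
    have h2 : (1 : MvPolynomial (Fin m) L) ∈ RingHom.ker (constantCoeff : MvPolynomial (Fin m) L →+* L) := h1 (h ▸ Submodule.mem_top)
    simp [RingHom.mem_ker] at h2
  have hXdeg : ∀ i : Fin m, (X i : MvPolynomial (Fin m) L) ^ e ∈ homZ (Fin m) L e := fun i => by
    simpa using pow_mem_homZ (X_mem_homZ (R := L) i) e
  obtain ⟨g, A, B, hg, hgli, hAB, h1, h2⟩ := exists_regularSeq hrad hne
  obtain ⟨g', A', B', hg', hgli', hAB', h1', h2'⟩ := exists_regularSeq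
    (F := fun i : Fin m => (X i : MvPolynomial (Fin m) L) ^ e)
    (fun i => ⟨e, Ideal.subset_span ⟨i, rfl⟩⟩) hXne
  -- Hilbert functions of regular sequences of equal degrees agree, so it suffices to know the
  -- answer for the powers `X i ^ e`.
  have hcount := hg.finrank_degPart_eq hg' (hdeg hF h2) (hdeg hXdeg h2') hgli.ne_zero hgli'.ne_zero D
  rw [← hlin h1 h2, ← hlin h1' h2'] at hcount
  have hX : degPart (Ideal.span (Set.range fun i : Fin m => (X i : MvPolynomial (Fin m) L) ^ e)) D =
      homZ (Fin m) L D :=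
    le_antisymm inf_le_right fun x hx => ⟨homZ_le_span_X_pow hm e hD x hx, hx⟩
  rw [hX] at hcount
  have : degPart (Ideal.span (Set.range F)) D = homZ (Fin m) L D :=
    Submodule.eq_of_le_of_finrank_le inf_le_right hcount.ge
  exact (this ▸ hu : u ∈ degPart (Ideal.span (Set.range F)) D).1

/-- An ideal of finite colength generated by forms contains powers of the variables. -/
theorem X_mem_radical_of_finite {e : ℤ} {F : Fin m → MvPolynomial (Fin m) L} (hF : ∀ i, F i ∈ homZ (Fin m) L e)
    (hfin : Module.Finite L (MvPolynomial (Fin m) L ⧸ Ideal.span (Set.range F))) (i : Fin m) :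
    X i ∈ (Ideal.span (Set.range F)).radical := by
  have hint := (Algebra.IsIntegral.of_finite L (MvPolynomial (Fin m) L ⧸ Ideal.span (Set.range F))).isIntegral
    (Ideal.Quotient.mk (Ideal.span (Set.range F)) (X i))
  obtain ⟨p, hp, hp0⟩ := hint
  have hmem : Polynomial.aeval (X i : MvPolynomial (Fin m) L) p ∈ Ideal.span (Set.range F) := by
    rw [← Ideal.Quotient.eq_zero_iff_mem, ← hp0]
    change (Ideal.Quotient.mkₐ L (Ideal.span (Set.range F))) (Polynomial.aeval (X i) p) = _
    rw [← Polynomial.aeval_algHom_apply, Polynomial.aeval_def]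
    rfl
  refine ⟨p.natDegree, ?_⟩
  -- The terms of `p(X i)` have distinct degrees and the ideal is homogeneous, so it contains the
  -- top term, a power of `X i` because `p` is monic.
  have h1 := homComp_mem_span (e := e) (by rintro _ ⟨j, rfl⟩; exact hF j) hmem p.natDegree
  rw [Polynomial.aeval_eq_sum_range, map_sum, Finset.sum_range_succ, Finset.sum_eq_zero, zero_add,
    hp.coeff_natDegree, one_smul, homComp_of_mem] at h1
  · exact h1
  · simpa using pow_mem_homZ (X_mem_homZ (R := L) i) p.natDegree
  · intro k hk
    rw [map_smul, homComp_of_mem_ne (D := k), smul_zero]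
    · simpa using pow_mem_homZ (X_mem_homZ (R := L) i) k
    · have := Finset.mem_range.1 hk
      omega

end CompleteIntersection

end Telescoping

namespace Telescoping

open MvPolynomial

/-! ### Calculus of derivations of fraction fields -/

namespace IsDerivation

variable {R : Type*} [CommRing R] {D : R → R}

theorem map_zero (hD : IsDerivation D) : D 0 = 0 := by
  have := hD.map_add 0 0
  rw [add_zero] at this
  linear_combination -this

theorem map_sum (hD : IsDerivation D) {ι : Type*} (s : Finset ι) (x : ι → R) :
    D (∑ i ∈ s, x i) = ∑ i ∈ s, D (x i) := by
  classical
  induction s using Finset.induction_on with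
  | empty => simp [hD.map_zero]
  | insert i s hi ih => rw [Finset.sum_insert hi, Finset.sum_insert hi, hD.map_add, ih]

/-- The extra factor `x` avoids the exponent `m - 1`. -/
theorem mul_pow (hD : IsDerivation D) (x : R) (m : ℕ) : x * D (x ^ m) = m * x ^ m * D x := by
  induction m with
  | zero =>
    have := hD.leibniz 1 1
    simp only [one_mul, mul_one] at this
    rw [pow_zero, show D 1 = 0 by linear_combination -this]
    simp
  | succ m ih =>
    rw [pow_succ', hD.leibniz, mul_add, ih]
    push_cast
    ring

variable [IsDomain R] (K : Type*) [Field K] [Algebra R K] [IsFractionRing R K]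

theorem fracDer_algebraMap (hD : IsDerivation D) (p : R) :
    fracDer K D (algebraMap R K p) = algebraMap R K (D p) := by
  have h := fracDer_div K hD p 1 one_ne_zero
  have h1 : D 1 = 0 := by simpa using hD.mul_pow 1 0
  simpa [h1] using h

theorem fracDer_frac (hD : IsDerivation D) (g f : R) (hf : f ≠ 0) (m : ℕ) :
    fracDer K D (algebraMap R K g / algebraMap R K f ^ m) =
      algebraMap R K (f * D g - m * g * D f) / algebraMap R K f ^ (m + 1) := by
  have hf' : algebraMap R K f ≠ 0 := fun h =>
    hf (IsFractionRing.injective R K (by rw [h, _root_.map_zero]))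
  have h := fracDer_div K hD g (f ^ m) (pow_ne_zero m hf)
  rw [map_pow] at h
  rw [h]
  have h2 := congrArg (algebraMap R K) (hD.mul_pow f m)
  simp only [map_mul, map_pow, map_natCast] at h2
  rw [div_eq_div_iff (pow_ne_zero _ (pow_ne_zero _ hf')) (pow_ne_zero _ hf')]
  simp only [map_sub, map_mul, map_natCast]
  linear_combination (-algebraMap R K g * algebraMap R K f ^ m) * h2

protected theorem fracDer (hD : IsDerivation D) : IsDerivation (fracDer K D) := by
  have hinj := IsFractionRing.injective R K
  constructor <;> intro x y <;>
    obtain ⟨p, q, hq, rfl⟩ := IsFractionRing.div_surjective (A := R) x <;>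
    obtain ⟨u, v, hv, rfl⟩ := IsFractionRing.div_surjective (A := R) y <;>
    have hq0 := nonZeroDivisors.ne_zero hq <;>
    have hv0 := nonZeroDivisors.ne_zero hv <;>
    have hq' : algebraMap R K q ≠ 0 := (map_ne_zero_iff _ hinj).2 hq0 <;>
    have hv' : algebraMap R K v ≠ 0 := (map_ne_zero_iff _ hinj).2 hv0
  · have e : algebraMap R K p / algebraMap R K q + algebraMap R K u / algebraMap R K v =
        algebraMap R K (p * v + u * q) / algebraMap R K (q * v) := by
      simp only [_root_.map_add, map_mul]; field_simp
    rw [e, fracDer_div K hD _ _ (mul_ne_zero hq0 hv0), fracDer_div K hD _ _ hq0,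
      fracDer_div K hD _ _ hv0]
    simp only [hD.map_add, hD.leibniz, _root_.map_add, map_mul]
    field_simp
    ring
  · have e : algebraMap R K p / algebraMap R K q * (algebraMap R K u / algebraMap R K v) =
        algebraMap R K (p * u) / algebraMap R K (q * v) := by
      simp only [map_mul]; field_simp
    rw [e, fracDer_div K hD _ _ (mul_ne_zero hq0 hv0), fracDer_div K hD _ _ hq0,
      fracDer_div K hD _ _ hv0]
    simp only [hD.leibniz, _root_.map_add, map_mul]
    field_simp
    ring

end IsDerivation

theorem isDerivation_pderiv {σ R : Type*} [CommRing R] (i : σ) :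
    IsDerivation fun p : MvPolynomial σ R => pderiv i p :=
  ⟨fun x y => map_add _ x y, fun x y => by simp only [pderiv_mul]; ring⟩

section MapCoeff

variable {σ L : Type*} [CommRing L] {D : L → L}

theorem coeff_mapCoeff (hD : IsDerivation D) (p : MvPolynomial σ L) (m : σ →₀ ℕ) :
    coeff m (mapCoeff D p) = D (coeff m p) := by
  classical
  rw [mapCoeff, coeff_sum]
  simp only [coeff_monomial, Finset.sum_ite_eq']
  split_ifs with h
  · rfl
  · rw [notMem_support_iff.1 h, hD.map_zero]

theorem IsDerivation.mapCoeff (hD : IsDerivation D) :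
    IsDerivation fun p : MvPolynomial σ L => mapCoeff D p := by
  classical
  constructor <;> intro x y <;> ext m
  · simp only [coeff_mapCoeff hD, coeff_add, hD.map_add]
  · simp only [coeff_mapCoeff hD, coeff_add, coeff_mul, hD.map_sum, hD.leibniz,
      Finset.sum_add_distrib]

end MapCoeff

/-! ### Exact rational functions -/

section Exact

variable {L K : Type*} [Field L] {n : ℕ} [Field K] [Algebra (MvPolynomial (Fin (n + 1)) L) K]
  {f : MvPolynomial (Fin (n + 1)) L}

theorem frac_add (g h : MvPolynomial (Fin (n + 1)) L) (m : ℕ) :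
    frac K (g + h) f m = frac K g f m + frac K h f m := by
  simp only [frac, map_add, add_div]

theorem frac_sub (g h : MvPolynomial (Fin (n + 1)) L) (m : ℕ) :
    frac K (g - h) f m = frac K g f m - frac K h f m := by
  simp only [frac, map_sub, sub_div]

theorem frac_zero (m : ℕ) : frac K (0 : MvPolynomial (Fin (n + 1)) L) f m = 0 := by
  simp [frac]

theorem frac_sum {ι : Type*} (s : Finset ι) (g : ι → MvPolynomial (Fin (n + 1)) L) (m : ℕ) :
    frac K (∑ i ∈ s, g i) f m = ∑ i ∈ s, frac K (g i) f m := by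
  simp only [frac, map_sum, Finset.sum_div]

theorem frac_mul (g h : MvPolynomial (Fin (n + 1)) L) (m : ℕ) :
    frac K (g * h) f m = algebraMap _ K g * frac K h f m := by
  simp only [frac, map_mul, mul_div_assoc]

variable [IsFractionRing (MvPolynomial (Fin (n + 1)) L) K]

/-- `G` is a sum of derivatives `∂ⱼ Aⱼ` with `Aⱼ ∈ L[x, 1/f]`. -/
def IsExact (f : MvPolynomial (Fin (n + 1)) L) (G : K) : Prop :=
  ∃ A : Fin (n + 1) → K, (∀ j, IsRegularAway K f (A j)) ∧ G = ∑ j, dx K (L := L) j (A j)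

theorem algebraMap_ne_zero_of_ne_zero (hf : f ≠ 0) :
    algebraMap (MvPolynomial (Fin (n + 1)) L) K f ≠ 0 :=
  (map_ne_zero_iff _ (IsFractionRing.injective _ K)).2 hf

variable (K) in
theorem frac_mul_pow (hf : f ≠ 0) (g : MvPolynomial (Fin (n + 1)) L) (m k : ℕ) :
    frac K (g * f ^ k) f (m + k) = frac K g f m := by
  have := algebraMap_ne_zero_of_ne_zero (K := K) hf
  simp only [frac, map_mul, map_pow]
  rw [pow_add, mul_div_mul_right _ _ (pow_ne_zero _ this)]

theorem frac_injective (hf : f ≠ 0) {g h : MvPolynomial (Fin (n + 1)) L} {m : ℕ}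
    (e : frac K g f m = frac K h f m) : g = h := by
  have := algebraMap_ne_zero_of_ne_zero (K := K) hf
  rw [frac, frac, div_left_inj' (pow_ne_zero _ this)] at e
  exact IsFractionRing.injective _ K e

theorem dx_frac (hf : f ≠ 0) (j : Fin (n + 1)) (g : MvPolynomial (Fin (n + 1)) L) (m : ℕ) :
    dx K (L := L) j (frac K g f m) =
      frac K (f * pderiv j g - (m : MvPolynomial (Fin (n + 1)) L) * g * pderiv j f) f (m + 1) :=
  (isDerivation_pderiv j).fracDer_frac K g f hf m

theorem isDerivation_dx (j : Fin (n + 1)) : IsDerivation (dx K (L := L) j) :=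
  (isDerivation_pderiv j).fracDer K

theorem IsRegularAway.add (hf : f ≠ 0) {G H : K} (hG : IsRegularAway K f G)
    (hH : IsRegularAway K f H) : IsRegularAway K f (G + H) := by
  obtain ⟨g, m, rfl⟩ := hG
  obtain ⟨h, s, rfl⟩ := hH
  refine ⟨g * f ^ s + h * f ^ m, m + s, ?_⟩
  rw [frac_add, frac_mul_pow K hf, add_comm m s, frac_mul_pow K hf]

theorem IsExact.add (hf : f ≠ 0) {G H : K} (hG : IsExact f G) (hH : IsExact f H) :
    IsExact f (G + H) := by
  obtain ⟨A, hA, rfl⟩ := hG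
  obtain ⟨B, hB, rfl⟩ := hH
  refine ⟨fun j => A j + B j, fun j => (hA j).add hf (hB j), ?_⟩
  simp only [(isDerivation_dx _).map_add, Finset.sum_add_distrib]

theorem IsExact.C_mul {G : K} (hG : IsExact f G) (c : L) :
    IsExact f (algebraMap (MvPolynomial (Fin (n + 1)) L) K (C c) * G) := by
  obtain ⟨A, hA, rfl⟩ := hG
  refine ⟨fun j => algebraMap (MvPolynomial (Fin (n + 1)) L) K (C c) * A j, fun j => ?_, ?_⟩
  · obtain ⟨g, m, h⟩ := hA j
    exact ⟨C c * g, m, by rw [frac_mul, ← h]⟩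
  · rw [Finset.mul_sum]
    refine Finset.sum_congr rfl fun j _ => ?_
    rw [(isDerivation_dx j).leibniz, dx, (isDerivation_pderiv j).fracDer_algebraMap K, pderiv_C]
    simp

theorem isExact_zero : IsExact f (0 : K) :=
  ⟨fun _ => 0, fun _ => ⟨0, 0, by simp [frac]⟩, by simp [(isDerivation_dx _).map_zero]⟩

theorem IsExact.neg {G : K} (hG : IsExact f G) : IsExact f (-G) := by
  simpa using hG.C_mul (-1 : L)

theorem IsExact.sum (hf : f ≠ 0) {ι : Type*} (s : Finset ι) {G : ι → K}
    (hG : ∀ i ∈ s, IsExact f (G i)) : IsExact f (∑ i ∈ s, G i) := by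
  classical
  induction s using Finset.induction_on with
  | empty => simpa using isExact_zero
  | insert i s hi ih =>
    rw [Finset.sum_insert hi]
    exact (hG i (Finset.mem_insert_self i s)).add hf
      (ih fun j hj => hG j (Finset.mem_insert_of_mem hj))

/-- Converts exactness into the polynomial hypothesis of `griffiths`. The exponent `s` dominates `q`
and the pole orders of all components of the certificate. -/
theorem IsExact.exists_common_denominator (hf : f ≠ 0) {q : ℕ}
    {u : MvPolynomial (Fin (n + 1)) L} (h : IsExact f (frac K u f q)) :
    ∃ (s : ℕ) (g : Fin (n + 1) → MvPolynomial (Fin (n + 1)) L), q ≤ s ∧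
      u * f ^ (s + 1 - q) =
        ∑ j, (f * pderiv j (g j) - (s : MvPolynomial (Fin (n + 1)) L) * g j * pderiv j f) := by
  obtain ⟨A, hA, hu⟩ := h
  choose g m hg using hA
  set s := q + ∑ j, m j with hs
  have hms : ∀ j, m j ≤ s := fun j =>
    (Finset.single_le_sum (fun i _ => Nat.zero_le (m i)) (Finset.mem_univ j)).trans
      (Nat.le_add_left _ _)
  refine ⟨s, fun j => g j * f ^ (s - m j), Nat.le_add_right _ _,
    frac_injective (K := K) hf (m := s + 1) ?_⟩
  have h1 : ∀ j, A j = frac K (g j * f ^ (s - m j)) f s := fun j => by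
    have := frac_mul_pow K hf (g j) (m j) (s - m j)
    rw [Nat.add_sub_cancel' (hms j)] at this
    rw [this, hg]
  have h2 := frac_mul_pow K hf u q (s + 1 - q)
  rw [Nat.add_sub_cancel' (by omega)] at h2
  rw [h2, hu, frac_sum]
  exact Finset.sum_congr rfl fun j _ => by rw [h1, dx_frac hf]

/-- The Griffiths–Dwork reduction: `(∑ bⱼ ∂ⱼf) / f^(q+1)` and `(1/q) (∑ ∂ⱼbⱼ) / f^q` differ by an
exact function. -/
theorem isExact_griffiths_dwork [CharZero L] (hf : f ≠ 0) {q : ℕ} (hq : q ≠ 0)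
    (b : Fin (n + 1) → MvPolynomial (Fin (n + 1)) L) :
    IsExact f (frac K (∑ j, b j * pderiv j f) f (q + 1) -
      frac K (C (q : L)⁻¹ * ∑ j, pderiv j (b j)) f q) := by
  have hq0 : (q : L) ≠ 0 := by exact_mod_cast hq
  have hqC : C (q : L)⁻¹ * (q : MvPolynomial (Fin (n + 1)) L) = 1 := by
    rw [← map_natCast (C : L →+* MvPolynomial (Fin (n + 1)) L), ← map_mul, inv_mul_cancel₀ hq0,
      map_one]
  have h : IsExact f (∑ j, dx K (L := L) j (frac K (b j) f q)) :=
    ⟨fun j => frac K (b j) f q, fun j => ⟨b j, q, rfl⟩, rfl⟩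
  have h1 := h.C_mul (-(q : L)⁻¹)
  convert h1 using 1
  rw [← frac_mul_pow K hf _ q 1, ← frac_sub, Finset.sum_congr rfl fun j _ => dx_frac hf j (b j) q,
    ← frac_sum, ← frac_mul]
  congr 1
  rw [Finset.sum_sub_distrib, ← Finset.mul_sum, map_neg]
  have : ∑ j, (q : MvPolynomial (Fin (n + 1)) L) * b j * pderiv j f =
      q * ∑ j, b j * pderiv j f := by
    rw [Finset.mul_sum]; exact Finset.sum_congr rfl fun j _ => by ring
  rw [this]
  linear_combination (-∑ j, b j * pderiv j f) * hqC

end Exact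

/-! ### Successive `t`-derivatives of a fraction -/

section Derivatives

variable {k : Type*} [Field k] {n : ℕ}

/-- The derivation `∂/∂t` of `k[t, ε][x]`. -/
noncomputable def dtPoly (p : MvPolynomial (Fin (n + 1)) (ParamRing k)) :
    MvPolynomial (Fin (n + 1)) (ParamRing k) :=
  mapCoeff (fun c : ParamRing k => pderiv 0 c) p

/-- The numerator of `∂ₜ^i (a / f^l)` as a fraction with denominator `f^(l+i)`. -/
noncomputable def dtNumerator (f a : MvPolynomial (Fin (n + 1)) (ParamRing k)) (l : ℕ) :
    ℕ → MvPolynomial (Fin (n + 1)) (ParamRing k)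
  | 0 => a
  | i + 1 => f * dtPoly (dtNumerator f a l i) -
      ((l + i : ℕ) : MvPolynomial (Fin (n + 1)) (ParamRing k)) * dtNumerator f a l i * dtPoly f

theorem coeff_dtPoly (p : MvPolynomial (Fin (n + 1)) (ParamRing k)) (m : Fin (n + 1) →₀ ℕ) :
    coeff m (dtPoly p) = pderiv 0 (coeff m p) :=
  coeff_mapCoeff (isDerivation_pderiv 0) p m

variable {L K : Type*} [Field L] [Algebra (ParamRing k) L]
  [IsFractionRing (ParamRing k) L] [Field K] [Algebra (MvPolynomial (Fin (n + 1)) L) K]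
  [IsFractionRing (MvPolynomial (Fin (n + 1)) L) K]

theorem iterate_dt_frac (f a : MvPolynomial (Fin (n + 1)) (ParamRing k)) (hf : f ≠ 0) (l i : ℕ) :
    (dt k L K (n := n))^[i]
      (frac K (map (algebraMap (ParamRing k) L) a) (map (algebraMap (ParamRing k) L) f) l) =
    frac K (map (algebraMap (ParamRing k) L) (dtNumerator f a l i))
      (map (algebraMap (ParamRing k) L) f) (l + i) := by
  have hinj := IsFractionRing.injective (ParamRing k) L
  have hf' : map (algebraMap (ParamRing k) L) f ≠ 0 :=
    (map_ne_zero_iff _ (map_injective _ hinj)).2 hf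
  have hdL : IsDerivation (dtField k L) := (isDerivation_pderiv 0).fracDer L
  have hmap : ∀ p : MvPolynomial (Fin (n + 1)) (ParamRing k),
      mapCoeff (dtField k L) (map (algebraMap (ParamRing k) L) p) =
        map (algebraMap (ParamRing k) L) (dtPoly p) := by
    intro p
    ext m
    rw [coeff_mapCoeff hdL, coeff_map, coeff_map, coeff_dtPoly]
    exact (isDerivation_pderiv (0 : Fin 2)).fracDer_algebraMap L _
  induction i with
  | zero => rfl
  | succ i ih =>
    rw [Function.iterate_succ_apply', ih]
    refine (hdL.mapCoeff.fracDer_frac K _ _ hf' (l + i)).trans ?_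
    rw [hmap, hmap]
    simp only [dtNumerator, frac, map_sub, map_mul, map_natCast]
    rfl

theorem dtNumerator_mem_homZ {f a : MvPolynomial (Fin (n + 1)) (ParamRing k)} {d : ℕ} {e : ℤ}
    {l : ℕ} (hf : f ∈ homZ (Fin (n + 1)) (ParamRing k) d)
    (ha : a ∈ homZ (Fin (n + 1)) (ParamRing k) (l * d + e)) (i : ℕ) :
    dtNumerator f a l i ∈ homZ (Fin (n + 1)) (ParamRing k) ((l + i : ℕ) * d + e) := by
  have hdt : ∀ {p : MvPolynomial (Fin (n + 1)) (ParamRing k)} {D : ℤ},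
      p ∈ homZ (Fin (n + 1)) (ParamRing k) D → dtPoly p ∈ homZ (Fin (n + 1)) (ParamRing k) D := by
    intro p D hp m hm
    refine hp m fun h => hm ?_
    rw [coeff_dtPoly, h, map_zero]
  induction i with
  | zero => simpa [dtNumerator] using ha
  | succ i ih =>
    refine Submodule.sub_mem _ (mul_mem_homZ hf (hdt ih) (by push_cast; ring)) ?_
    have h : dtNumerator f a l i * dtPoly f ∈
        homZ (Fin (n + 1)) (ParamRing k) ((l + (i + 1) : ℕ) * d + e) :=
      mul_mem_homZ ih (hdt hf) (by push_cast; ring)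
    have h' := nsmul_mem h (l + i)
    rw [nsmul_eq_mul, ← mul_assoc] at h'
    exact h'

end Derivatives

/-! ### Degrees in the parameters -/

section ParamLE

variable {k : Type*} [Field k] {n : ℕ}

/-- All the coefficients of `p` have degree at most `N` in the parameter `v`. -/
def ParamLE (v : Fin 2) (N : ℕ) (p : MvPolynomial (Fin (n + 1)) (ParamRing k)) : Prop :=
  ∀ m, (p.coeff m).degreeOf v ≤ N

theorem paramLE_paramDegree (v : Fin 2) (p : MvPolynomial (Fin (n + 1)) (ParamRing k)) :
    ParamLE v (paramDegree v p) p := by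
  intro m
  by_cases h : m ∈ p.support
  · exact Finset.le_sup (f := fun m => (p.coeff m).degreeOf v) h
  · rw [notMem_support_iff.1 h]; simp

variable {v : Fin 2} {M N Q : ℕ} {p q : MvPolynomial (Fin (n + 1)) (ParamRing k)}

theorem ParamLE.mono (hp : ParamLE v M p) (h : M ≤ N) : ParamLE v N p := fun m => (hp m).trans h

theorem paramLE_zero : ParamLE v N (0 : MvPolynomial (Fin (n + 1)) (ParamRing k)) := fun m => by
  simp

theorem ParamLE.sub (hp : ParamLE v N p) (hq : ParamLE v N q) : ParamLE v N (p - q) := fun m => by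
  rw [coeff_sub]
  exact (degreeOf_sub_le v _ _).trans (max_le (hp m) (hq m))

theorem ParamLE.sum {ι : Type*} (s : Finset ι)
    {g : ι → MvPolynomial (Fin (n + 1)) (ParamRing k)} (hg : ∀ i ∈ s, ParamLE v N (g i)) :
    ParamLE v N (∑ i ∈ s, g i) := fun m => by
  rw [coeff_sum]
  exact (degreeOf_sum_le v s _).trans (Finset.sup_le fun i hi => hg i hi m)

theorem ParamLE.mul (hp : ParamLE v M p) (hq : ParamLE v N q) (h : M + N ≤ Q) :
    ParamLE v Q (p * q) := fun m => by
  classical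
  rw [coeff_mul]
  exact (degreeOf_sum_le v _ _).trans (Finset.sup_le fun x _ =>
    (degreeOf_mul_le v _ _).trans ((Nat.add_le_add (hp _) (hq _)).trans h))

theorem paramLE_monomial (m : Fin (n + 1) →₀ ℕ) {c : ParamRing k} (h : c.degreeOf v ≤ N) :
    ParamLE v N (monomial m c) := fun m' => by
  classical
  rw [coeff_monomial]
  split_ifs
  · exact h
  · simp

theorem paramLE_C {c : ParamRing k} (h : c.degreeOf v ≤ N) :
    ParamLE v N (C c : MvPolynomial (Fin (n + 1)) (ParamRing k)) := paramLE_monomial 0 h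

theorem paramLE_natCast (j : ℕ) :
    ParamLE v 0 (j : MvPolynomial (Fin (n + 1)) (ParamRing k)) := by
  rw [← map_natCast (C : ParamRing k →+* MvPolynomial (Fin (n + 1)) (ParamRing k))]
  refine paramLE_C ?_
  rw [← map_natCast (C : k →+* ParamRing k), degreeOf_C]

theorem ParamLE.pderiv (hp : ParamLE v N p) (i : Fin (n + 1)) :
    ParamLE v N (MvPolynomial.pderiv i p) := fun m => by
  rw [coeff_pderiv]
  refine (degreeOf_mul_le v _ _).trans ?_
  have : ((m i : ParamRing k) + 1).degreeOf v = 0 := by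
    rw [← Nat.cast_succ, ← map_natCast (C : k →+* ParamRing k), degreeOf_C]
  rw [this, add_zero]
  exact hp _

theorem degreeOf_pderiv_le {σ R : Type*} [CommRing R] (v i : σ) (p : MvPolynomial σ R) :
    (MvPolynomial.pderiv i p).degreeOf v ≤ p.degreeOf v := by
  classical
  rw [degreeOf_le_iff]
  intro m hm
  rw [mem_support_iff, coeff_pderiv] at hm
  have h1 := (degreeOf_le_iff (f := p) (d := p.degreeOf v) (n := v)).1 le_rfl _
    (mem_support_iff.2 (left_ne_zero_of_mul hm))
  exact le_trans (by simp) h1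

theorem ParamLE.dtPoly (hp : ParamLE v N p) : ParamLE v N (dtPoly p) := fun m => by
  rw [coeff_dtPoly]
  exact (degreeOf_pderiv_le v 0 _).trans (hp m)

/-- Each differentiation multiplies the numerator once by `f` or by its `t`-derivative, and so costs
at most the degree of `f`. -/
theorem paramLE_dtNumerator {f a : MvPolynomial (Fin (n + 1)) (ParamRing k)}
    (hf : ParamLE v M f) (ha : ParamLE v N a) (l i : ℕ) :
    ParamLE v (N + i * M) (dtNumerator f a l i) := by
  induction i with
  | zero => simpa [dtNumerator] using ha
  | succ i ih =>
    refine ParamLE.sub (hf.mul ih.dtPoly (by ring_nf; rfl)) ?_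
    exact ((paramLE_natCast _).mul ih (Nat.zero_add _).le).mul hf.dtPoly (by ring_nf; rfl)

end ParamLE

end Telescoping

namespace Telescoping

open MvPolynomial

/-! ### Minors -/

section Minors

/-- The vectors `(w b x)_b` span `F^r`, since a linear form vanishing on all of them is a relation
between the `w b`. A basis extracted from them gives the points `I`. -/
theorem exists_det_ne_zero {F ι : Type*} [Field F] {r : ℕ} {w : Fin r → ι → F}
    (hw : LinearIndependent F w) :
    ∃ I : Fin r → ι, (Matrix.of fun a b => w b (I a)).det ≠ 0 := by
  classical
  let e : ι → Fin r → F := fun x b => w b x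
  have hspan : Submodule.span F (Set.range e) = ⊤ := by
    by_contra hne
    obtain ⟨φ, hφ, hle⟩ := Submodule.exists_le_ker_of_lt_top _ (lt_top_iff_ne_top.2 hne)
    have h1 : ∀ v : Fin r → F, φ v = ∑ b, v b * φ (Pi.single b 1) := fun v => by
      conv_lhs => rw [pi_eq_sum_univ' v]
      simp only [map_sum, map_smul, smul_eq_mul]
    have h2 : ∑ b, φ (Pi.single b 1) • w b = 0 := by
      ext x
      have : φ (e x) = 0 := hle (Submodule.subset_span ⟨x, rfl⟩)
      rw [h1] at this
      rw [Finset.sum_apply, Pi.zero_apply, ← this]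
      exact Finset.sum_congr rfl fun b _ => mul_comm _ _
    have h3 := Fintype.linearIndependent_iff.1 hw _ h2
    refine hφ (LinearMap.ext fun v => ?_)
    rw [h1]
    simp [h3]
  obtain ⟨κ, a, -, ha, hli⟩ := exists_linearIndependent' F e
  rw [hspan] at ha
  let bas := Module.Basis.mk hli ha.ge
  have : Fintype κ := FiniteDimensional.fintypeBasisIndex bas
  have hcard : Fintype.card κ = r := by
    rw [← Module.finrank_eq_card_basis bas, Module.finrank_fin_fun]
  let eq : Fin r ≃ κ := (Fintype.equivFinOfCardEq hcard).symm
  refine ⟨fun i => a (eq i), ?_⟩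
  have hrows : LinearIndependent F (Matrix.of fun i b => w b (a (eq i))).row :=
    hli.comp eq eq.injective
  have := (Matrix.linearIndependent_rows_iff_isUnit).1 hrows
  exact ((Matrix.isUnit_iff_isUnit_det _).1 this).ne_zero

/-- The vector of signed maximal minors spans the kernel of a matrix of corank one. -/
theorem kernel_eq_minors {R : Type*} [CommRing R] [IsDomain R] {r : ℕ}
    (M : Matrix (Fin r) (Fin (r + 1)) R) (c : Fin (r + 1) → R) (hc : M.mulVec c = 0)
    (hdet : (M.submatrix id Fin.castSucc).det ≠ 0) (i : Fin (r + 1)) :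
    c (Fin.last r) * ((-1) ^ (i : ℕ) * (M.submatrix id i.succAbove).det) =
      (-1) ^ r * (M.submatrix id Fin.castSucc).det * c i := by
  set y : Fin (r + 1) → R := fun i => (-1) ^ (i : ℕ) * (M.submatrix id i.succAbove).det with hy
  -- Laplace expansion of the square matrix obtained by repeating the row `a` of `M` on top.
  have hyM : M.mulVec y = 0 := by
    ext a
    let N : Matrix (Fin (r + 1)) (Fin (r + 1)) R := Matrix.of (Fin.cons (M a) M)
    have hN : N.det = 0 := Matrix.det_zero_of_row_eq (i := 0) (j := a.succ)
      (Fin.succ_ne_zero a).symm rfl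
    rw [Matrix.det_succ_row_zero] at hN
    rw [Pi.zero_apply, ← hN, Matrix.mulVec, dotProduct]
    refine Finset.sum_congr rfl fun j _ => ?_
    rw [hy, mul_left_comm, ← mul_assoc]
    rfl
  have hlast : y (Fin.last r) = (-1) ^ r * (M.submatrix id Fin.castSucc).det := by
    simp only [hy, Fin.val_last]
    congr 3
    exact Fin.succAbove_last
  -- This kernel vector has last coordinate `0`, hence is killed by an invertible square block.
  let z : Fin (r + 1) → R := fun i => c (Fin.last r) * y i - y (Fin.last r) * c i
  have hz : M.mulVec z = 0 := by
    have : z = c (Fin.last r) • y - y (Fin.last r) • c := rfl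
    rw [this, Matrix.mulVec_sub, Matrix.mulVec_smul, Matrix.mulVec_smul, hc, hyM]
    simp
  have hz' : (M.submatrix id Fin.castSucc).mulVec (fun j => z j.castSucc) = 0 := by
    ext a
    have := congrFun hz a
    rw [Matrix.mulVec, dotProduct, Fin.sum_univ_castSucc] at this
    have hzl : z (Fin.last r) = 0 := by simp only [z]; ring
    rw [hzl, mul_zero, add_zero] at this
    exact this
  have h0 := Matrix.eq_zero_of_mulVec_eq_zero hdet hz'
  rw [← hlast]
  refine Fin.lastCases (mul_comm _ _) (fun j => ?_) i
  exact sub_eq_zero.1 (congrFun h0 j)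

/-- One weight per column: the columns used later come from derivatives of different orders, with
different degrees. -/
theorem degreeOf_det_le {σ R : Type*} [CommRing R] (v : σ) {r : ℕ}
    (M : Matrix (Fin r) (Fin r) (MvPolynomial σ R)) (w : Fin r → ℕ)
    (h : ∀ a b, (M a b).degreeOf v ≤ w b) : M.det.degreeOf v ≤ ∑ b, w b := by
  classical
  rw [Matrix.det_apply]
  refine (degreeOf_sum_le v _ _).trans (Finset.sup_le fun s _ => ?_)
  rw [Units.smul_def, zsmul_eq_mul, ← map_intCast (C : R →+* MvPolynomial σ R)]
  exact (degreeOf_C_mul_le _ v _).trans ((degreeOf_prod_le v _ _).trans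
    (Finset.sum_le_sum fun b _ => h _ b))

/-- A cofactor is a determinant with one row replaced by a unit vector; transposed, it becomes a
column of weight `0`. -/
theorem degreeOf_adjugate_le {σ R : Type*} [CommRing R] (v : σ) {r : ℕ}
    (M : Matrix (Fin r) (Fin r) (MvPolynomial σ R)) (δ : ℕ)
    (h : ∀ a b, (M a b).degreeOf v ≤ δ) (i j : Fin r) :
    (M.adjugate i j).degreeOf v ≤ (r - 1) * δ := by
  classical
  rw [Matrix.adjugate_apply, ← Matrix.det_transpose]
  refine (degreeOf_det_le v _ (fun b => if b = j then 0 else δ) fun a b => ?_).trans ?_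
  · rw [Matrix.transpose_apply, Matrix.updateRow_apply]
    split_ifs with hb
    · rw [Pi.single_apply]
      split_ifs
      · simp
      · simp
    · exact h _ _
  · rw [Finset.sum_ite, Finset.sum_const_zero, zero_add, Finset.sum_const, smul_eq_mul,
      Finset.filter_ne' , Finset.card_erase_of_mem (Finset.mem_univ _), Finset.card_univ,
      Fintype.card_fin]

end Minors

/-! ### Macaulay matrices -/

section Macaulay

variable {k L : Type*} [Field k] [Field L] [Algebra (ParamRing k) L]
  [IsFractionRing (ParamRing k) L] {n : ℕ}

/-- Reduction of the monomials of degree `D` modulo the ideal generated by the `F j`, with a common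
denominator `P`: the monomials in `B` are a basis of a complement of the ideal. -/
theorem exists_macaulay_reduction (F : Fin (n + 1) → MvPolynomial (Fin (n + 1)) (ParamRing k))
    {e : ℤ} (hF : ∀ j, F j ∈ homZ (Fin (n + 1)) (ParamRing k) e) (D : ℤ) {N : ℕ}
    (hN : Module.finrank L (homZ (Fin (n + 1)) L D) ≤ N) {δ : Fin 2 → ℕ}
    (hδ : ∀ v j, ParamLE v (δ v) (F j)) :
    ∃ (P : ParamRing k) (B : Set (Fin (n + 1) →₀ ℕ)), P ≠ 0 ∧
      (∀ v, P.degreeOf v ≤ N * δ v) ∧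
      (∀ m : Fin (n + 1) →₀ ℕ, (m.degree : ℤ) = D →
        ∃ (ρ : MvPolynomial (Fin (n + 1)) (ParamRing k))
          (b : Fin (n + 1) → MvPolynomial (Fin (n + 1)) (ParamRing k)),
          (∀ m', ρ.coeff m' ≠ 0 → m' ∈ B) ∧ ρ ∈ homZ (Fin (n + 1)) (ParamRing k) D ∧
          (∀ j, b j ∈ homZ (Fin (n + 1)) (ParamRing k) (D - e)) ∧
          (∀ v, ParamLE v (N * δ v) ρ) ∧ (∀ v j, ParamLE v (N * δ v) (b j)) ∧
          C P * monomial m 1 = ρ + ∑ j, b j * F j) ∧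
      ∀ u ∈ homZ (Fin (n + 1)) L D, (∀ m, u.coeff m ≠ 0 → m ∈ B) →
        u ∈ Ideal.span (Set.range fun j => map (algebraMap (ParamRing k) L) (F j)) → u = 0 := by
  classical
  have hinj := IsFractionRing.injective (ParamRing k) L
  set φ := map (σ := Fin (n + 1)) (algebraMap (ParamRing k) L) with hφ
  let T := Fin (n + 1) × {τ : Fin (n + 1) →₀ ℕ // (τ.degree : ℤ) = D - e}
  let y : T → MvPolynomial (Fin (n + 1)) (ParamRing k) := fun x => monomial x.2.1 1 * F x.1
  have hy : ∀ x, y x ∈ homZ (Fin (n + 1)) (ParamRing k) D := fun x =>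
    mul_mem_homZ (monomial_mem_homZ x.2.2 1) (hF x.1) (by ring)
  have hyL : ∀ x, φ (y x) ∈ homZ (Fin (n + 1)) L D := fun x => map_mem_homZ _ (hy x)
  -- Among the multiples of the `F j` by monomials, `J` selects an `L`-basis of the degree `D` part
  -- of the ideal, whence `s ≤ N`.
  obtain ⟨s, J, hsN, hJspan, hJ⟩ : ∃ (s : ℕ) (J : Fin s → T), s ≤ N ∧
      Submodule.span L (Set.range fun b => φ (y (J b))) =
        Submodule.span L (Set.range fun x => φ (y x)) ∧
      LinearIndependent L fun b => φ (y (J b)) := by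
    obtain ⟨κ, J, -, h1, h2⟩ := exists_linearIndependent' L fun x => φ (y x)
    have h3 : LinearIndependent L fun b : κ => (⟨φ (y (J b)), hyL _⟩ : homZ (Fin (n + 1)) L D) :=
      LinearIndependent.of_comp (homZ (Fin (n + 1)) L D).subtype h2
    have hfin : Finite κ := h3.finite
    have : Fintype κ := Fintype.ofFinite κ
    have hcard := h3.fintype_card_le_finrank
    let eq : Fin (Fintype.card κ) ≃ κ := (Fintype.equivFin κ).symm
    refine ⟨Fintype.card κ, fun b => J (eq b), hcard.trans hN, ?_, h2.comp eq eq.injective⟩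
    rw [← h1]
    congr 1
    exact eq.surjective.range_comp fun x => φ (y (J x))
  have hw : LinearIndependent L fun b m => coeff m (φ (y (J b))) := by
    rw [Fintype.linearIndependent_iff] at hJ ⊢
    intro c hc
    refine hJ c (MvPolynomial.ext _ _ fun m => ?_)
    have := congrFun hc m
    simpa [coeff_sum, Finset.sum_apply] using this
  obtain ⟨I, hI⟩ := exists_det_ne_zero hw
  -- A nonzero maximal minor of the Macaulay matrix. Its determinant serves as `P`, and `B` consists
  -- of the monomials that do not index its rows.
  let A : Matrix (Fin s) (Fin s) (ParamRing k) := Matrix.of fun a b => coeff (I a) (y (J b))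
  have hAL : (Matrix.of fun a b => coeff (I a) (φ (y (J b)))) =
      (algebraMap (ParamRing k) L).mapMatrix A := by
    ext a b
    exact coeff_map _ _ _
  have hA0 : A.det ≠ 0 := by
    intro h
    refine hI ?_
    rw [hAL, ← RingHom.map_det, h, map_zero]
  have hyδ : ∀ v x, ParamLE v (δ v) (y x) := fun v x =>
    (paramLE_monomial (N := 0) _ (by simp)).mul (hδ v x.1) (by omega)
  have hAdeg : ∀ v a b, (A a b).degreeOf v ≤ δ v := fun v a b => hyδ v _ _
  have hdetdeg : ∀ v, A.det.degreeOf v ≤ s * δ v := fun v => by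
    refine (degreeOf_det_le v A (fun _ => δ v) (hAdeg v)).trans ?_
    simp
  have hsδ : ∀ v, s * δ v ≤ N * δ v := fun v => Nat.mul_le_mul_right _ hsN
  refine ⟨A.det, {m | m ∉ Set.range I}, hA0, fun v => (hdetdeg v).trans (hsδ v), fun m hm => ?_,
    fun u hu huB huJ => ?_⟩
  · let c : Fin s → ParamRing k := fun a => coeff (I a) (monomial m (1 : ParamRing k))
    have hcdeg : ∀ v a, (c a).degreeOf v ≤ 0 := fun v a =>
      paramLE_monomial (N := 0) (v := v) m (by simp) (I a)
    -- Cramer's rule without division: `A x = det A • c`, so subtracting `∑ x_b y_b` clears the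
    -- coefficients at the monomials `I a`.
    let x : Fin s → ParamRing k := A.adjugate.mulVec c
    have hxdeg : ∀ v b, (x b).degreeOf v ≤ (s - 1) * δ v := fun v b => by
      refine (degreeOf_sum_le v _ _).trans (Finset.sup_le fun a _ =>
        (degreeOf_mul_le v _ _).trans ?_)
      exact (Nat.add_le_add (degreeOf_adjugate_le v A (δ v) (hAdeg v) b a) (hcdeg v a)).trans
        (Nat.add_zero _).le
    -- The index `b` forces `s ≥ 1`; with the truncated `s - 1` the inequality may fail for `s = 0`.
    have hxs : ∀ v (b : Fin s), (s - 1) * δ v + δ v ≤ s * δ v := fun v b => by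
      have : s - 1 + 1 = s := by have := b.2; omega
      calc (s - 1) * δ v + δ v = (s - 1 + 1) * δ v := by ring
        _ ≤ s * δ v := by rw [this]
    let ρ := C A.det * monomial m (1 : ParamRing k) - ∑ b, C (x b) * y (J b)
    let B : Fin (n + 1) → MvPolynomial (Fin (n + 1)) (ParamRing k) := fun j =>
      ∑ b, if (J b).1 = j then C (x b) * monomial (J b).2.1 1 else 0
    refine ⟨ρ, B, fun m' hm' => ?_, ?_, fun j => ?_, fun v => ?_, fun v j => ?_, ?_⟩
    · rintro ⟨a, rfl⟩
      apply hm'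
      have h1 : A.mulVec x = A.det • c := by
        simp only [x, Matrix.mulVec_mulVec, Matrix.mul_adjugate, Matrix.smul_mulVec,
          Matrix.one_mulVec]
      have h2 := congrFun h1 a
      simp only [ρ, coeff_sub, coeff_sum, coeff_C_mul]
      rw [Pi.smul_apply, smul_eq_mul] at h2
      rw [sub_eq_zero]
      rw [← h2, Matrix.mulVec, dotProduct]
      exact Finset.sum_congr rfl fun b _ => mul_comm _ _
    · exact Submodule.sub_mem _ (mul_mem_homZ (C_mem_homZ _) (monomial_mem_homZ hm 1) (by ring))
        (Submodule.sum_mem _ fun b _ => mul_mem_homZ (C_mem_homZ _) (hy _) (by ring))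
    · refine Submodule.sum_mem _ fun b _ => ?_
      split_ifs
      · exact mul_mem_homZ (C_mem_homZ _) (monomial_mem_homZ (J b).2.2 1) (by ring)
      · exact Submodule.zero_mem _
    · refine ParamLE.mono (ParamLE.sub ?_ (ParamLE.sum _ fun b _ => ?_)) (hsδ v)
      · exact (paramLE_C (hdetdeg v)).mul (paramLE_monomial (N := 0) _ (by simp)) (by omega)
      · exact (paramLE_C (hxdeg v b)).mul (hyδ v _) (hxs v b)
    · refine ParamLE.mono (ParamLE.sum _ fun b _ => ?_) (hsδ v)
      split_ifs
      · refine (paramLE_C (hxdeg v b)).mul (paramLE_monomial (N := 0) _ (by simp)) ?_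
        have := hxs v b
        omega
      · exact paramLE_zero
    · have h1 : ∑ j, B j * F j = ∑ b, C (x b) * y (J b) := by
        simp only [B, Finset.sum_mul]
        rw [Finset.sum_comm]
        refine Finset.sum_congr rfl fun b _ => ?_
        simp only [ite_mul, zero_mul, Finset.sum_ite_eq, Finset.mem_univ, if_true, y, mul_assoc]
      rw [h1]
      simp only [ρ]
      ring
  · obtain ⟨b, hb, rfl⟩ := span_homZ_homogeneous (fun j => map_mem_homZ (algebraMap _ L) (hF j))
      hu huJ
    have hmem : ∑ j, b j * map (algebraMap (ParamRing k) L) (F j) ∈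
        Submodule.span L (Set.range fun x => φ (y x)) := by
      refine Submodule.sum_mem _ fun j _ => ?_
      rw [as_sum (b j), Finset.sum_mul]
      refine Submodule.sum_mem _ fun τ hτ => ?_
      have hτ' := hb j τ (mem_support_iff.1 hτ)
      have : monomial τ (coeff τ (b j)) * map (algebraMap (ParamRing k) L) (F j) =
          coeff τ (b j) • φ (y (j, ⟨τ, hτ'⟩)) := by
        simp only [y, map_mul, hφ, map_monomial, map_one]
        rw [← smul_mul_assoc, smul_monomial, smul_eq_mul, mul_one]
      rw [this]
      exact Submodule.smul_mem _ _ (Submodule.subset_span ⟨_, rfl⟩)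
    rw [← hJspan, Submodule.mem_span_range_iff_exists_fun] at hmem
    obtain ⟨c, hc⟩ := hmem
    rw [← hc] at huB ⊢
    -- An element of the ideal supported on `B` has zero coefficients at the `I a`, so its
    -- coordinates `c` lie in the kernel of the invertible minor.
    have hc0 : (Matrix.of fun a b => coeff (I a) (φ (y (J b)))).mulVec c = 0 := by
      ext a
      by_contra h
      refine huB (I a) (fun h' => h ?_) ⟨a, rfl⟩
      rw [coeff_sum] at h'
      rw [Pi.zero_apply, ← h', Matrix.mulVec, dotProduct]
      refine Finset.sum_congr rfl fun b _ => ?_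
      rw [coeff_smul, smul_eq_mul, mul_comm]
      rfl
    have := Matrix.eq_zero_of_mulVec_eq_zero hI hc0
    simp [this]

end Macaulay

end Telescoping

namespace Telescoping

open MvPolynomial

/-! ### Dimension counts -/

theorem finrank_homZ_le {L : Type*} [Field L] (n e : ℕ) :
    Module.finrank L (homZ (Fin (n + 1)) L e) ≤ (e + n).choose n := by
  classical
  let s : Finset (Fin (n + 1) →₀ ℕ) := Finset.univ.finsuppAntidiag e
  have hle : homZ (Fin (n + 1)) L e ≤
      Submodule.span L (s.image fun m => (monomial m (1 : L))) := by
    intro u hu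
    rw [as_sum u]
    refine Submodule.sum_mem _ fun m hm => ?_
    have h1 := hu m (mem_support_iff.1 hm)
    have h2 : monomial m (coeff m u) = coeff m u • monomial m (1 : L) := by
      rw [smul_monomial, smul_eq_mul, mul_one]
    rw [h2]
    refine Submodule.smul_mem _ _ (Submodule.subset_span ?_)
    refine Finset.mem_coe.2 (Finset.mem_image.2 ⟨m, ?_, rfl⟩)
    rw [Finset.mem_finsuppAntidiag]
    refine ⟨?_, Finset.subset_univ _⟩
    rw [← Finsupp.degree_eq_sum]
    exact_mod_cast h1
  have h1 := Submodule.finrank_mono hle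
  have h2 := finrank_span_finset_le_card (R := L) (s.image fun m => (monomial m (1 : L)))
  have h3 : s.card = (e + n).choose n := by
    rw [Finset.card_finsuppAntidiag_nat_eq_choose, Finset.card_univ, Fintype.card_fin,
      Nat.choose_symm_of_eq_add (show e + n = n + e by omega)]
    congr 1
    omega
  exact h1.trans (h2.trans (Finset.card_image_le.trans h3.le))

/-- The ratio of consecutive terms is `(1 + 1/(n+1))^(n+1) ≤ e`. -/
theorem succ_pow_div_factorial_le_exp (n : ℕ) :
    ((n : ℝ) + 1) ^ n / n.factorial ≤ Real.exp 1 ^ n := by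
  induction n with
  | zero => simp
  | succ n ih =>
    have hn : (0 : ℝ) < (n : ℝ) + 1 := by positivity
    have h1 : (1 + 1 / ((n : ℝ) + 1)) ^ (n + 1) ≤ Real.exp 1 := by
      have h := Real.add_one_le_exp (1 / ((n : ℝ) + 1))
      calc (1 + 1 / ((n : ℝ) + 1)) ^ (n + 1) ≤ Real.exp (1 / ((n : ℝ) + 1)) ^ (n + 1) :=
            pow_le_pow_left₀ (by positivity) (by linarith) _
        _ = Real.exp 1 := by
            rw [← Real.exp_nat_mul]
            congr 1
            push_cast
            field_simp
    have h2 : (((n + 1 : ℕ) : ℝ) + 1) ^ (n + 1) / ((n + 1).factorial : ℝ) =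
        (1 + 1 / ((n : ℝ) + 1)) ^ (n + 1) * (((n : ℝ) + 1) ^ n / n.factorial) := by
      have hf : (n.factorial : ℝ) ≠ 0 := by exact_mod_cast n.factorial_ne_zero
      have h3 : (1 + 1 / ((n : ℝ) + 1)) = ((n : ℝ) + 1 + 1) / ((n : ℝ) + 1) := by field_simp
      rw [h3, div_pow, Nat.factorial_succ]
      push_cast
      field_simp
      ring
    rw [h2, pow_succ' (Real.exp 1)]
    exact mul_le_mul h1 ih (by positivity) (Real.exp_pos 1).le

/-- Source of the factor `e^n d^n`: the binomial is at most `((n+1) d)^n / n!`. -/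
theorem choose_le_exp_mul_pow (n d : ℕ) :
    ((((n + 1) * d - 1).choose n : ℕ) : ℝ) ≤ Real.exp 1 ^ n * (d : ℝ) ^ n := by
  calc ((((n + 1) * d - 1).choose n : ℕ) : ℝ) ≤ ((((n + 1) * d - 1 : ℕ) : ℝ)) ^ n / n.factorial :=
        Nat.choose_le_pow_div n _
    _ ≤ (((n : ℝ) + 1) * d) ^ n / n.factorial := by
        gcongr
        calc (((n + 1) * d - 1 : ℕ) : ℝ) ≤ (((n + 1) * d : ℕ) : ℝ) := by
              exact_mod_cast Nat.sub_le _ _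
          _ = ((n : ℝ) + 1) * d := by push_cast; ring
    _ = ((n : ℝ) + 1) ^ n / n.factorial * (d : ℝ) ^ n := by rw [mul_pow]; ring
    _ ≤ Real.exp 1 ^ n * (d : ℝ) ^ n := by
        gcongr
        exact succ_pow_div_factorial_le_exp n

/-! ### Normal forms of rational functions modulo exact ones -/

section NormalForm

variable {k : Type*} [Field k] (L : Type*) [Field L] [Algebra (ParamRing k) L] {n : ℕ}

/-- The polynomial `f` with its coefficients viewed in `L = k(t, ε)`. -/
noncomputable abbrev toL (p : MvPolynomial (Fin (n + 1)) (ParamRing k)) :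
    MvPolynomial (Fin (n + 1)) L :=
  map (algebraMap (ParamRing k) L) p

/-- One step of the reduction of the pole order of fractions with denominator `f ^ q`: the common
denominator `P`, and the monomials `B` allowed in the numerators of reduced fractions. -/
structure Reducer (f : MvPolynomial (Fin (n + 1)) (ParamRing k)) (d N : ℕ) (δ : Fin 2 → ℕ) (q : ℕ)
    (P : ParamRing k) (B : Set (Fin (n + 1) →₀ ℕ)) : Prop where
  ne_zero : P ≠ 0
  degree_le : ∀ v, P.degreeOf v ≤ N * δ v
  -- Lowering a pole of order `q` divides by `q - 1`, so nothing is reduced for `q ≤ 1`.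
  trivial : q ≤ 1 → P = 1 ∧ B = Set.univ
  reduce : 2 ≤ q → ∀ m : Fin (n + 1) →₀ ℕ, (m.degree : ℤ) = q * d - n - 1 →
    ∃ (ρ : MvPolynomial (Fin (n + 1)) (ParamRing k))
      (b : Fin (n + 1) → MvPolynomial (Fin (n + 1)) (ParamRing k)),
      (∀ m', ρ.coeff m' ≠ 0 → m' ∈ B) ∧
      ρ ∈ homZ (Fin (n + 1)) (ParamRing k) (q * d - n - 1) ∧
      (∀ j, b j ∈ homZ (Fin (n + 1)) (ParamRing k) (q * d - n - 1 - (d - 1))) ∧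
      (∀ v, ParamLE v (N * δ v) ρ) ∧ (∀ v j, ParamLE v (N * δ v) (b j)) ∧
      C P * monomial m 1 = ρ + ∑ j, b j * pderiv j f
  unique : 2 ≤ q → ∀ u ∈ homZ (Fin (n + 1)) L (q * d - n - 1),
    (∀ m, u.coeff m ≠ 0 → m ∈ B) → u ∈ jacobianIdeal (toL L f) → u = 0

theorem jacobianIdeal_toL (f : MvPolynomial (Fin (n + 1)) (ParamRing k)) :
    jacobianIdeal (toL L f) = Ideal.span (Set.range fun j => toL L (pderiv j f)) := by
  simp only [jacobianIdeal, toL, pderiv_map]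

theorem charZero_of_paramRing (k L : Type*) [Field k] [CharZero k] [Field L]
    [Algebra (ParamRing k) L] : CharZero L :=
  charZero_of_injective_ringHom
    ((algebraMap (ParamRing k) L).comp (C : k →+* ParamRing k)).injective

variable {L} {f : MvPolynomial (Fin (n + 1)) (ParamRing k)} {d : ℕ} {δ : Fin 2 → ℕ}

/-- The threshold `(n+1)(d-1)` is exactly the degree of the numerators over `f^(n+1)`. -/
theorem mem_jacobianIdeal_of_degree [CharZero k] (hf : f ∈ homZ (Fin (n + 1)) (ParamRing k) d) (hd : 1 ≤ d)
    (hreg : IsRegularPoly (toL L f)) {D : ℤ} (hD : ((n : ℤ) + 1) * (d - 1) ≤ D)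
    {u : MvPolynomial (Fin (n + 1)) L} (hu : u ∈ homZ (Fin (n + 1)) L D) :
    u ∈ jacobianIdeal (toL L f) := by
  have := charZero_of_paramRing k L
  have hF : ∀ j, pderiv j (toL L f) ∈ homZ (Fin (n + 1)) L ((d - 1 : ℕ) : ℤ) := fun j =>
    pderiv_mem_homZ (map_mem_homZ _ hf) j (by push_cast [hd]; ring)
  exact homZ_le_span_of_radical (Nat.succ_pos n) hF (X_mem_radical_of_finite hF hreg)
    (by push_cast [hd]; exact hD) hu

theorem Reducer.reduce_all {N q : ℕ} {P : ParamRing k} {B : Set (Fin (n + 1) →₀ ℕ)}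
    (hP : Reducer L f d N δ q P B) (hq : 2 ≤ q)
    {u : MvPolynomial (Fin (n + 1)) (ParamRing k)}
    (hu : u ∈ homZ (Fin (n + 1)) (ParamRing k) (q * d - n - 1)) {A : Fin 2 → ℕ}
    (hA : ∀ v, ParamLE v (A v) u) :
    ∃ (ρ : MvPolynomial (Fin (n + 1)) (ParamRing k))
      (b : Fin (n + 1) → MvPolynomial (Fin (n + 1)) (ParamRing k)),
      (∀ m', ρ.coeff m' ≠ 0 → m' ∈ B) ∧
      ρ ∈ homZ (Fin (n + 1)) (ParamRing k) (q * d - n - 1) ∧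
      (∀ j, b j ∈ homZ (Fin (n + 1)) (ParamRing k) (q * d - n - 1 - (d - 1))) ∧
      (∀ v, ParamLE v (A v + N * δ v) ρ) ∧ (∀ v j, ParamLE v (A v + N * δ v) (b j)) ∧
      C P * u = ρ + ∑ j, b j * pderiv j f := by
  have hsupp : ∀ m : u.support, ((m : Fin (n + 1) →₀ ℕ).degree : ℤ) = q * d - n - 1 := fun m =>
    hu m (mem_support_iff.1 m.2)
  choose ρ b h1 h2 h3 h4 h5 h6 using fun m : u.support => hP.reduce hq m (hsupp m)
  refine ⟨∑ m : u.support, C (coeff m u) * ρ m, fun j => ∑ m : u.support, C (coeff m u) * b m j, fun m' hm' => ?_,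
    Submodule.sum_mem _ fun m _ => mul_mem_homZ (C_mem_homZ _) (h2 m) (by ring),
    fun j => Submodule.sum_mem _ fun m _ => mul_mem_homZ (C_mem_homZ _) (h3 m j) (by ring),
    fun v => ParamLE.sum _ fun m _ => (paramLE_C (hA v m)).mul (h4 m v) le_rfl,
    fun v j => ParamLE.sum _ fun m _ => (paramLE_C (hA v m)).mul (h5 m v j) le_rfl, ?_⟩
  · rw [coeff_sum] at hm'
    obtain ⟨m, -, hne⟩ := Finset.exists_ne_zero_of_sum_ne_zero hm'
    rw [coeff_C_mul] at hne
    exact h1 m m' (right_ne_zero_of_mul hne)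
  · have hu' : u = ∑ m : u.support, C (coeff m u) * monomial (m : Fin (n + 1) →₀ ℕ) 1 := by
      conv_lhs => rw [as_sum u, ← Finset.sum_coe_sort]
      refine Finset.sum_congr rfl fun m _ => ?_
      rw [C_mul_monomial, mul_one]
    conv_lhs => rw [hu', Finset.mul_sum]
    simp only [Finset.sum_mul]
    rw [Finset.sum_comm, ← Finset.sum_add_distrib]
    refine Finset.sum_congr rfl fun m _ => ?_
    rw [mul_left_comm, h6, mul_add, Finset.mul_sum]
    simp only [mul_assoc]

variable [IsFractionRing (ParamRing k) L]

variable (L) in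
theorem toL_injective : Function.Injective (toL (k := k) (n := n) L) :=
  map_injective _ (IsFractionRing.injective _ _)

variable (L) in
theorem toL_eq_zero {p : MvPolynomial (Fin (n + 1)) (ParamRing k)} : toL L p = 0 ↔ p = 0 :=
  map_eq_zero_iff _ (toL_injective L)

variable [CharZero k]

/-- Only pole orders from `2` to `n + 1` need their own Macaulay matrix. Beyond, each monomial is a
multiple of one in the degree belonging to `n + 1`, where everything lies in the Jacobian ideal: the
same `P` serves with `B = ∅`, and `N` does not depend on `q`. -/
theorem exists_reducer (hf : f ∈ homZ (Fin (n + 1)) (ParamRing k) d) (hd : 1 ≤ d)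
    (hreg : IsRegularPoly (toL L f)) (hδ : ∀ v, ParamLE v (δ v) f) (q : ℕ) :
    ∃ (P : ParamRing k) (B : Set (Fin (n + 1) →₀ ℕ)),
      Reducer L f d (((n + 1) * d - 1).choose n) δ q P B := by
  classical
  have hf1 : ∀ j, pderiv j f ∈ homZ (Fin (n + 1)) (ParamRing k) ((d : ℤ) - 1) := fun j =>
    pderiv_mem_homZ hf j rfl
  have hrank : ∀ q : ℕ, q ≤ n + 1 → Module.finrank L (homZ (Fin (n + 1)) L ((q : ℤ) * d - n - 1)) ≤
      ((n + 1) * d - 1).choose n := by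
    intro q hq
    by_cases hD : (q : ℤ) * d - n - 1 < 0
    · have : homZ (Fin (n + 1)) L ((q : ℤ) * d - n - 1) = ⊥ :=
        (Submodule.eq_bot_iff _).2 fun x hx => homZ_neg hD hx
      rw [this, finrank_bot]
      exact Nat.zero_le _
    · obtain ⟨e, he⟩ := Int.eq_ofNat_of_zero_le (not_lt.1 hD)
      rw [he]
      refine (finrank_homZ_le n e).trans (Nat.choose_le_choose n ?_)
      have h1 : q * d ≤ (n + 1) * d := Nat.mul_le_mul_right d hq
      have h2 : ((q * d : ℕ) : ℤ) = e + n + 1 := by push_cast; linarith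
      omega
  by_cases hq1 : q ≤ 1
  · exact ⟨1, Set.univ, one_ne_zero, fun v => by simp, fun _ => ⟨rfl, rfl⟩, fun h => by omega,
      fun h => by omega⟩
  by_cases hq : q ≤ n + 1
  · obtain ⟨P, B, h1, h2, h3, h4⟩ := exists_macaulay_reduction (L := L) (fun j => pderiv j f) hf1 _
      (hrank q hq) fun v j => (hδ v).pderiv j
    refine ⟨P, B, h1, h2, fun h => by omega, fun _ => h3, fun _ u hu hB hJ => h4 u hu hB ?_⟩
    rwa [jacobianIdeal_toL] at hJ
  · obtain ⟨P, B, h1, h2, h3, h4⟩ := exists_macaulay_reduction (L := L) (fun j => pderiv j f) hf1 _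
      (hrank (n + 1) le_rfl) fun v j => (hδ v).pderiv j
    refine ⟨P, ∅, h1, h2, fun h => by omega, fun _ m hm => ?_, fun _ u _ hB _ => ?_⟩
    · have htop : ((n + 1) * (d - 1) : ℕ) ≤ m.degree := by
        have h5 : ((n + 1 : ℕ) : ℤ) * d ≤ q * d := by
          exact_mod_cast Nat.mul_le_mul_right d (by omega : n + 1 ≤ q)
        zify [hd]
        rw [hm]
        push_cast at h5
        linarith
      obtain ⟨τ, hτm, hτ⟩ := Finsupp.exists_le_degree_eq m _ htop
      have hτ' : (τ.degree : ℤ) = ((n + 1 : ℕ) : ℤ) * d - n - 1 := by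
        rw [hτ]; push_cast [hd]; ring
      obtain ⟨ρ, b, g1, g2, g3, g4, g5, g6⟩ := h3 τ hτ'
      have hρ : ρ = 0 := by
        rw [← toL_eq_zero L]
        have hmem : ∀ D, ∀ w ∈ homZ (Fin (n + 1)) L D, ((n : ℤ) + 1) * (d - 1) ≤ D →
            w ∈ Ideal.span (Set.range fun j => toL L (pderiv j f)) := fun D w hw hD => by
          rw [← jacobianIdeal_toL]
          exact mem_jacobianIdeal_of_degree hf hd hreg hD hw
        refine h4 _ (map_mem_homZ _ g2) (fun m' hm' => g1 m' fun h => hm' ?_)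
          (hmem _ _ (map_mem_homZ _ g2) ?_)
        · rw [coeff_map, h, map_zero]
        · push_cast; linarith
      rw [hρ, zero_add] at g6
      refine ⟨0, fun j => monomial (m - τ) 1 * b j, by simp, Submodule.zero_mem _, fun j => ?_,
        fun v => paramLE_zero, fun v j => ?_, ?_⟩
      · refine mul_mem_homZ (monomial_mem_homZ rfl 1) (g3 j) ?_
        have : m.degree = (m - τ).degree + τ.degree := by
          rw [← map_add, tsub_add_cancel_of_le hτm]
        rw [← hm, this, ← hτ']
        push_cast
        ring
      · exact (paramLE_monomial (N := 0) _ (by simp)).mul (g5 v j) (by omega)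
      · have hfac : monomial m (1 : ParamRing k) = monomial (m - τ) 1 * monomial τ 1 := by
          rw [monomial_mul, tsub_add_cancel_of_le hτm, mul_one]
        rw [hfac, mul_left_comm, g6, Finset.mul_sum, zero_add]
        exact Finset.sum_congr rfl fun j _ => by ring
    · ext m
      by_contra h
      exact hB m h

variable {K : Type*} [Field K] [Algebra (MvPolynomial (Fin (n + 1)) L) K]
  [IsFractionRing (MvPolynomial (Fin (n + 1)) L) K]

-- Each pole order from `q` down to `2` costs one factor `P s` and a degree `N * δ v`; orders `0`
-- and `1` are free, whence the truncated `q - 1`.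
variable (K) in
theorem exists_normalForm (hf0 : f ≠ 0)
    {N : ℕ} {P : ℕ → ParamRing k} {B : ℕ → Set (Fin (n + 1) →₀ ℕ)}
    (hP : ∀ q, Reducer L f d N δ q (P q) (B q)) (q : ℕ) :
    ∀ {u : MvPolynomial (Fin (n + 1)) (ParamRing k)},
    u ∈ homZ (Fin (n + 1)) (ParamRing k) (q * d - n - 1) → ∀ {A : Fin 2 → ℕ},
    (∀ v, ParamLE v (A v) u) →
    ∃ ρ : ℕ → MvPolynomial (Fin (n + 1)) (ParamRing k),
      (∀ s : ℕ, ρ s ∈ homZ (Fin (n + 1)) (ParamRing k) (s * d - n - 1)) ∧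
      (∀ s m, (ρ s).coeff m ≠ 0 → m ∈ B s) ∧
      (∀ s v, ParamLE v (A v + (q - 1) * (N * δ v)) (ρ s)) ∧
      (∀ s, q < s → ρ s = 0) ∧
      IsExact (toL L f) (frac K (toL L (C (∏ s ∈ Finset.range (q + 1), P s) * u)) (toL L f) q -
        ∑ s ∈ Finset.range (q + 1), frac K (toL L (ρ s)) (toL L f) s) := by
  have hchar := charZero_of_paramRing k L
  have hfL : toL L f ≠ 0 := fun h => hf0 ((toL_eq_zero L).1 h)
  have hQ : ∀ q v, (∏ s ∈ Finset.range (q + 1), P s).degreeOf v ≤ (q - 1) * (N * δ v) := by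
    intro q v
    induction q with
    | zero => simp [((hP 0).trivial (by omega)).1]
    | succ q ih =>
      rw [Finset.prod_range_succ]
      refine (degreeOf_mul_le v _ _).trans ?_
      by_cases hq : q = 0
      · subst hq
        simp [((hP 0).trivial (by omega)).1, ((hP 1).trivial (by omega)).1]
      · have h1 := (hP (q + 1)).degree_le v
        have h2 : q + 1 - 1 = (q - 1) + 1 := by omega
        rw [h2, add_mul, one_mul]
        exact Nat.add_le_add ih h1
  induction q with
  | zero =>
    intro u hu A hA
    have : u = 0 := homZ_neg (by push_cast; omega) hu
    subst this
    refine ⟨fun _ => 0, fun s => Submodule.zero_mem _, by simp, fun s v => paramLE_zero, by simp, ?_⟩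
    simpa [frac] using isExact_zero
  | succ q ih =>
    intro u hu A hA
    by_cases hq : q = 0
    · subst hq
      refine ⟨fun s => if s = 1 then u else 0, fun s => ?_, fun s m hm => ?_, fun s v => ?_,
        fun s hs => if_neg (by omega), ?_⟩
      · dsimp only
        split_ifs with h
        · rw [h]; exact hu
        · exact Submodule.zero_mem _
      · dsimp only at hm
        split_ifs at hm with h
        · rw [h, ((hP 1).trivial le_rfl).2]; trivial
        · exact absurd (coeff_zero m) hm
      · dsimp only
        split_ifs
        · exact (hA v).mono (Nat.le_add_right _ _)
        · exact paramLE_zero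
      · simp only [Finset.prod_range_succ, Finset.prod_range_zero, Finset.sum_range_succ,
          Finset.sum_range_zero, ((hP 0).trivial (by omega)).1, ((hP 1).trivial le_rfl).1]
        simpa [frac] using isExact_zero
    · obtain ⟨ρ', b, h1, h2, h3, h4, h5, h6⟩ := (hP (q + 1)).reduce_all (by omega) hu hA
      -- The numerator over `f ^ q` that replaces the Jacobian part `∑ b_j ∂_j f` over `f ^ (q +
      -- 1)`.
      let u' : MvPolynomial (Fin (n + 1)) (ParamRing k) :=
        C (C (q : k)⁻¹) * ∑ j, pderiv j (b j)
      have hu' : u' ∈ homZ (Fin (n + 1)) (ParamRing k) (q * d - n - 1) := by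
        refine mul_mem_homZ (C_mem_homZ _) (Submodule.sum_mem _ fun j _ =>
          pderiv_mem_homZ (h3 j) j rfl) ?_
        push_cast
        ring
      have hA' : ∀ v, ParamLE v (A v + N * δ v) u' := fun v =>
        (paramLE_C (N := 0) (by rw [degreeOf_C])).mul
          (ParamLE.sum _ fun j _ => (h5 v j).pderiv j) (Nat.zero_add _).le
      obtain ⟨ρ, g1, g2, g3, g4, g5⟩ := ih hu' hA'
      have hdeg : ∀ v, A v + N * δ v + (q - 1) * (N * δ v) = A v + (q + 1 - 1) * (N * δ v) := by
        intro v
        have : q + 1 - 1 = (q - 1) + 1 := by omega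
        rw [this]
        ring
      set Q := ∏ s ∈ Finset.range (q + 1), P s with hQdef
      -- The remaining reductions multiply `u'` by `Q`, so the part `ρ'` already reduced is scaled
      -- by `Q` too.
      refine ⟨fun s => if s = q + 1 then C Q * ρ' else ρ s, fun s => ?_, fun s m hm => ?_,
        fun s v => ?_, fun s hs => ?_, ?_⟩
      · dsimp only
        split_ifs with h
        · rw [h]; exact mul_mem_homZ (C_mem_homZ _) h2 (by ring)
        · exact g1 s
      · dsimp only at hm
        split_ifs at hm with h
        · rw [h]
          rw [coeff_C_mul] at hm
          exact h1 m (right_ne_zero_of_mul hm)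
        · exact g2 s m hm
      · dsimp only
        split_ifs
        · exact (paramLE_C (hQ q v)).mul (h4 v) (by rw [← hdeg v]; omega)
        · exact (g3 s v).mono (hdeg v).le
      · dsimp only
        rw [if_neg (by omega)]
        exact g4 s (by omega)
      · have e1 : C (Q * P (q + 1)) * u = C Q * ρ' + C Q * ∑ j, b j * pderiv j f := by
          rw [map_mul, mul_assoc, h6, mul_add]
        have e2 : ∑ s ∈ Finset.range (q + 1),
            frac K (toL L (if s = q + 1 then C Q * ρ' else ρ s)) (toL L f) s =
            ∑ s ∈ Finset.range (q + 1), frac K (toL L (ρ s)) (toL L f) s :=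
          Finset.sum_congr rfl fun s hs => by
            rw [if_neg (by have := Finset.mem_range.1 hs; omega)]
        have e3 : toL L u' = C (q : L)⁻¹ * ∑ j, pderiv j (toL L (b j)) := by
          simp only [u', toL, map_mul, map_sum, map_C, pderiv_map]
          congr 2
          rw [← RingHom.comp_apply, map_inv₀, map_natCast]
        have e4 : toL L (C Q * ∑ j, b j * pderiv j f) =
            C (algebraMap _ L Q) * ∑ j, toL L (b j) * pderiv j (toL L f) := by
          simp only [toL, map_mul, map_sum, map_C, pderiv_map]
        have e5 : toL L (C Q * u') = C (algebraMap _ L Q) * toL L u' := by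
          simp only [toL, map_mul, map_C]
        dsimp only
        rw [Finset.prod_range_succ, ← hQdef, Finset.sum_range_succ _ (q + 1), if_pos rfl, e1, e2]
        have k1 := (isExact_griffiths_dwork (K := K) hfL hq fun j => toL L (b j)).C_mul
          (algebraMap _ L Q)
        rw [mul_sub, ← frac_mul, ← frac_mul, ← e4, ← e3, ← e5] at k1
        have k2 := k1.add hfL g5
        convert k2 using 1
        simp only [toL, map_add, frac_add]
        ring

/-- By `griffiths` the numerator over the highest power of `f` lies in the Jacobian ideal. The parts
of lower pole order carry a factor `f` of that ideal, so the top part lies in it as well; being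
supported on `B`, it vanishes, and induction applies. -/
theorem normalForm_unique (hf0 : f ≠ 0) (hf : f ∈ homZ (Fin (n + 1)) (ParamRing k) d)
    (hd : 1 ≤ d) (hn : 1 ≤ n) (hreg : IsRegularPoly (toL L f))
    {N : ℕ} {P : ℕ → ParamRing k} {B : ℕ → Set (Fin (n + 1) →₀ ℕ)}
    (hP : ∀ q, Reducer L f d N δ q (P q) (B q)) {σ : ℕ → MvPolynomial (Fin (n + 1)) L}
    (hσ : ∀ s : ℕ, σ s ∈ homZ (Fin (n + 1)) L (s * d - n - 1))
    (hB : ∀ s m, (σ s).coeff m ≠ 0 → m ∈ B s) (q : ℕ)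
    (hex : IsExact (toL L f) (∑ s ∈ Finset.range (q + 1), frac K (σ s) (toL L f) s)) :
    ∀ s ≤ q, σ s = 0 := by
  have hchar := charZero_of_paramRing k L
  have hfL : toL L f ≠ 0 := fun h => hf0 ((toL_eq_zero L).1 h)
  have hfdeg : toL L f ∈ homZ (Fin (n + 1)) L d := map_mem_homZ _ hf
  have hF : ∀ j, pderiv j (toL L f) ∈ homZ (Fin (n + 1)) L ((d : ℤ) - 1) := fun j =>
    pderiv_mem_homZ hfdeg j rfl
  have hsyz : TrivialSyzygies fun j => pderiv j (toL L f) :=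
    trivialSyzygies_of_radical (X_mem_radical_of_finite hF hreg)
  have h0 : σ 0 = 0 := homZ_neg (by push_cast; omega) (hσ 0)
  induction q with
  | zero =>
    intro s hs
    rw [Nat.le_zero.1 hs, h0]
  | succ q ih =>
    let u := ∑ s ∈ Finset.range (q + 1 + 1), σ s * toL L f ^ (q + 1 - s)
    have hu : u ∈ homZ (Fin (n + 1)) L ((q + 1 : ℕ) * d - n - 1) := by
      refine Submodule.sum_mem _ fun s hs => mul_mem_homZ (hσ s) (pow_mem_homZ hfdeg _) ?_
      have := Finset.mem_range.1 hs
      rw [Nat.cast_sub (by omega)]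
      ring
    have hufrac : frac K u (toL L f) (q + 1) =
        ∑ s ∈ Finset.range (q + 1 + 1), frac K (σ s) (toL L f) s := by
      rw [frac_sum]
      refine Finset.sum_congr rfl fun s hs => ?_
      have := Finset.mem_range.1 hs
      have h := frac_mul_pow K hfL (σ s) s (q + 1 - s)
      rwa [Nat.add_sub_cancel' (by omega)] at h
    rw [← hufrac] at hex
    obtain ⟨t, g, htq, hg⟩ := hex.exists_common_denominator hfL
    obtain ⟨hJ, hz⟩ := griffiths hd hn hfdeg hsyz htq hu hg
    have hsplit : u = (∑ s ∈ Finset.range (q + 1), σ s * toL L f ^ (q + 1 - s)) + σ (q + 1) := by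
      simp only [u]
      rw [Finset.sum_range_succ _ (q + 1), Nat.sub_self, pow_zero, mul_one]
    have hσq : σ (q + 1) = 0 := by
      by_cases hq : q = 0
      · subst hq
        rw [hz le_rfl] at hsplit
        simpa [h0] using hsplit.symm
      · refine (hP (q + 1)).unique (by omega) _ (hσ _) (hB _) ?_
        have h1 : ∑ s ∈ Finset.range (q + 1), σ s * toL L f ^ (q + 1 - s) ∈
            jacobianIdeal (toL L f) := by
          refine Ideal.sum_mem _ fun s hs => Ideal.mul_mem_left _ _ (Ideal.pow_mem_of_mem _
            (self_mem_jacobianIdeal hd hfdeg) _ ?_)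
          have := Finset.mem_range.1 hs
          omega
        have h2 := Ideal.sub_mem _ hJ h1
        rwa [hsplit, add_sub_cancel_left] at h2
    have hex' : IsExact (toL L f) (∑ s ∈ Finset.range (q + 1), frac K (σ s) (toL L f) s) := by
      rw [hufrac, Finset.sum_range_succ _ (q + 1), hσq, frac_zero, add_zero] at hex
      exact hex
    intro s hs
    rcases Nat.le_succ_iff.1 hs with h | h
    · exact ih hex' s h
    · rw [h, hσq]

end NormalForm

end Telescoping

namespace Telescoping

open MvPolynomial

/-! ### Proportional vectors over a factorial ring -/

/-- `c i₀` divides all `y i₀ * c i`, hence their gcd, which is `y i₀` up to a unit because `c` is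
primitive. -/
theorem dvd_of_primitive {R : Type*} [CommRing R] [IsDomain R] [UniqueFactorizationMonoid R]
    {ι : Type*} [Fintype ι] {c y : ι → R} {i₀ : ι} (hc0 : c i₀ ≠ 0)
    (hprim : ∀ g, (∀ i, g ∣ c i) → IsUnit g) (h : ∀ i, c i₀ * y i = y i₀ * c i) (i : ι) :
    c i ∣ y i := by
  classical
  let _ : StrongNormalizationMonoid R := UniqueFactorizationMonoid.strongNormalizationMonoid
  let _ : StrongNormalizedGCDMonoid R :=
    UniqueFactorizationMonoid.toStrongNormalizedGCDMonoid R
  have h1 : c i₀ ∣ Finset.univ.gcd fun i => y i₀ * c i :=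
    Finset.dvd_gcd fun i _ => ⟨y i, (h i).symm⟩
  have h2 : IsUnit (Finset.univ.gcd c) := hprim _ fun i => Finset.gcd_dvd (Finset.mem_univ i)
  have h3 : c i₀ ∣ y i₀ :=
    (IsUnit.dvd_mul_right h2).1 (h1.trans (Finset.gcd_mul_left' _ _ _).dvd)
  obtain ⟨g, hg⟩ := h3
  refine ⟨g, mul_left_cancel₀ hc0 ?_⟩
  rw [h, hg]
  ring

theorem degreeOf_le_of_dvd {σ R : Type*} [CommRing R] [IsDomain R] (v : σ)
    {p q : MvPolynomial σ R} (hq : q ≠ 0) (h : p ∣ q) : p.degreeOf v ≤ q.degreeOf v := by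
  obtain ⟨g, rfl⟩ := h
  rw [degreeOf_mul_eq (left_ne_zero_of_mul hq) (right_ne_zero_of_mul hq)]
  exact Nat.le_add_right _ _

/-- Source of the `r²` in the bound: `j` bounds the cost of differentiating and `j - 1`, truncated
at `j = 0`, that of the additional reductions. -/
theorem sum_add_pred (r : ℕ) : ∑ j ∈ Finset.range (r + 1), (j + (j - 1)) = r ^ 2 := by
  induction r with
  | zero => simp
  | succ r ih =>
    rw [Finset.sum_range_succ, ih, Nat.add_sub_cancel]
    ring

/-! ### The minimal telescoper -/

section Telescoper

variable {k L K : Type*} [Field k] [Field L] [Algebra (ParamRing k) L]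
  [IsFractionRing (ParamRing k) L] {n : ℕ} [Field K]
  [Algebra (MvPolynomial (Fin (n + 1)) L) K] [IsFractionRing (MvPolynomial (Fin (n + 1)) L) K]

theorem hasRegularCertificate_iff {f : MvPolynomial (Fin (n + 1)) L} {F : K} {r : ℕ}
    {c : Fin (r + 1) → L} : HasRegularCertificate k f F c ↔
      IsExact f (∑ i : Fin (r + 1),
        algebraMap (MvPolynomial (Fin (n + 1)) L) K (C (c i)) * (dt k L K (n := n))^[i] F) :=
  Iff.rfl

variable [CharZero k]

/-- The normal forms of the successive derivatives of `a / f ^ l`: a combination of the latter is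
exact if and only if the corresponding combination of the normal forms vanishes. -/
theorem exists_derivative_normalForms (hn : 1 ≤ n) {d l : ℕ} (hd : 1 ≤ d)
    {f a : MvPolynomial (Fin (n + 1)) (ParamRing k)} (hf0 : f ≠ 0)
    (hf : f ∈ homZ (Fin (n + 1)) (ParamRing k) d)
    (ha : a ∈ homZ (Fin (n + 1)) (ParamRing k) (l * d - n - 1)) (hreg : IsRegularPoly (toL L f))
    {A δ : Fin 2 → ℕ} (hA : ∀ v, ParamLE v (A v) a) (hδ : ∀ v, ParamLE v (δ v) f) :
    ∃ (P : ℕ → ParamRing k) (w : ℕ → ℕ × (Fin (n + 1) →₀ ℕ) → ParamRing k),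
      (∀ q, P q ≠ 0) ∧ (∀ q v, (P q).degreeOf v ≤ ((n + 1) * d - 1).choose n * δ v) ∧
      (∀ i x v, (w i x).degreeOf v ≤
        A v + i * δ v + (l + i - 1) * (((n + 1) * d - 1).choose n * δ v)) ∧
      ∀ (t : ℕ) (b : Fin t → L),
        (∀ x, ∑ i, b i * algebraMap (ParamRing k) L (w i x) = 0) ↔
        IsExact (toL L f) (∑ i : Fin t, algebraMap (MvPolynomial (Fin (n + 1)) L) K
          (C (b i * algebraMap (ParamRing k) L (∏ s ∈ Finset.range (l + i + 1), P s))) *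
            (dt k L K (n := n))^[i] (frac K (toL L a) (toL L f) l)) := by
  have hfL : toL L f ≠ 0 := fun h => hf0 ((toL_eq_zero L).1 h)
  choose P B hP using exists_reducer (L := L) hf hd hreg hδ
  have hnum : ∀ i, dtNumerator f a l i ∈
      homZ (Fin (n + 1)) (ParamRing k) ((l + i : ℕ) * d - n - 1) := fun i => by
    have := dtNumerator_mem_homZ (e := -n - 1) hf (l := l) (a := a)
      (by convert ha using 1; ring_nf) i
    convert this using 1
    ring_nf
  choose ρ h1 h2 h3 h4 h5 using fun i : ℕ => exists_normalForm K hf0 hP (l + i) (hnum i)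
    (A := fun v => A v + i * δ v) fun v => paramLE_dtNumerator (hδ v) (hA v) l i
  refine ⟨P, fun i x => coeff x.2 (ρ i x.1), fun q => (hP q).ne_zero, fun q => (hP q).degree_le,
    fun i x v => h3 i x.1 v x.2, fun t b => ?_⟩
  -- A pole order exceeding all the `l + i` with `i < t`, so that all normal forms are summed over
  -- one range.
  set q := l + t
  have hsum : ∀ i < t, ∑ s ∈ Finset.range (l + i + 1), frac K (toL L (ρ i s)) (toL L f) s =
      ∑ s ∈ Finset.range (q + 1), frac K (toL L (ρ i s)) (toL L f) s := by
    intro i hi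
    refine Finset.sum_subset (fun s hs => ?_) fun s _ hs => ?_
    · rw [Finset.mem_range] at hs ⊢
      omega
    · rw [h4 i s (by simpa using hs), (toL_eq_zero L).2 rfl, frac_zero]
  have hdiff : IsExact (toL L f) ((∑ i : Fin t, algebraMap (MvPolynomial (Fin (n + 1)) L) K
      (C (b i * algebraMap (ParamRing k) L (∏ s ∈ Finset.range (l + i + 1), P s))) *
        (dt k L K (n := n))^[i] (frac K (toL L a) (toL L f) l)) -
      ∑ s ∈ Finset.range (q + 1), frac K (∑ i : Fin t, C (b i) * toL L (ρ i s)) (toL L f) s) := by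
    have e : ∑ s ∈ Finset.range (q + 1), frac K (∑ i : Fin t, C (b i) * toL L (ρ i s)) (toL L f) s =
        ∑ i : Fin t, algebraMap (MvPolynomial (Fin (n + 1)) L) K (C (b i)) *
          ∑ s ∈ Finset.range (l + i + 1), frac K (toL L (ρ i s)) (toL L f) s := by
      simp only [frac_sum, frac_mul]
      rw [Finset.sum_comm]
      refine Finset.sum_congr rfl fun i _ => ?_
      rw [hsum i i.2, Finset.mul_sum]
    rw [e, ← Finset.sum_sub_distrib]
    refine IsExact.sum hfL _ fun i _ => ?_
    have := (h5 i).C_mul (b i)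
    convert this using 1
    rw [iterate_dt_frac f a hf0, mul_sub, ← frac_mul, ← frac_mul]
    simp only [toL, map_mul, map_C, mul_assoc]
  have hcoeff : (∀ x : ℕ × (Fin (n + 1) →₀ ℕ),
      ∑ i : Fin t, b i * algebraMap (ParamRing k) L (coeff x.2 (ρ i x.1)) = 0) ↔
      ∀ s, ∑ i : Fin t, C (b i) * toL L (ρ i s) = 0 := by
    constructor
    · intro h s
      ext m
      simpa [coeff_sum, coeff_C_mul, coeff_map] using h (s, m)
    · rintro h ⟨s, m⟩
      have := congrArg (coeff m) (h s)
      simpa [coeff_sum, coeff_C_mul, coeff_map] using this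
  rw [hcoeff]
  constructor
  · intro h
    simpa [h, frac_zero] using hdiff
  · intro h
    have hex := h.add hfL hdiff.neg
    rw [neg_sub, add_sub_cancel] at hex
    have huniq := normalForm_unique hf0 hf hd hn hreg hP
      (σ := fun s => ∑ i : Fin t, C (b i) * toL L (ρ i s))
      (fun s => Submodule.sum_mem _ fun i _ =>
        mul_mem_homZ (C_mem_homZ _) (map_mem_homZ _ (h1 i s)) (by ring))
      (fun s m hm => by
        rw [coeff_sum] at hm
        obtain ⟨i, -, hne⟩ := Finset.exists_ne_zero_of_sum_ne_zero hm
        rw [coeff_C_mul, coeff_map] at hne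
        exact h2 i s m fun h0 => right_ne_zero_of_mul hne (by rw [h0, map_zero])) q hex
    intro s
    by_cases hs : s ≤ q
    · exact huniq s hs
    · refine Finset.sum_eq_zero fun i _ => ?_
      rw [h4 i s (by have := i.2; omega), (toL_eq_zero L).2 rfl, mul_zero]

theorem degreeOf_minimalTelescoper_le (hn : 1 ≤ n) {d l r : ℕ} (hd : 1 ≤ d)
    {f a : MvPolynomial (Fin (n + 1)) (ParamRing k)} (hf0 : f ≠ 0)
    (hf : f ∈ homZ (Fin (n + 1)) (ParamRing k) d)
    (ha : a ∈ homZ (Fin (n + 1)) (ParamRing k) (l * d - n - 1)) (hreg : IsRegularPoly (toL L f))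
    {c : Fin (r + 1) → ParamRing k}
    (hc : IsMinimalTelescoper k (toL L f) (frac K (toL L a) (toL L f) l)
      fun i => algebraMap (ParamRing k) L (c i))
    (hprim : ∀ g : ParamRing k, (∀ i, g ∣ c i) → IsUnit g) (i : Fin (r + 1)) (v : Fin 2) :
    (c i).degreeOf v ≤ r * paramDegree v a +
      (r ^ 2 + r * l) * (((n + 1) * d - 1).choose n * paramDegree v f) := by
  classical
  set N := ((n + 1) * d - 1).choose n with hN
  obtain ⟨P, w, hP0, hPdeg, hwdeg, hw⟩ := exists_derivative_normalForms (K := K) (L := L) hn hd hf0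
    hf ha hreg (fun v => paramLE_paramDegree v a) fun v => paramLE_paramDegree v f
  have hinj := IsFractionRing.injective (ParamRing k) L
  set φ := algebraMap (ParamRing k) L with hφ
  have hφ0 : ∀ {x}, x ≠ 0 → φ x ≠ 0 := fun hx => (map_ne_zero_iff _ hinj).2 hx
  let Q : ℕ → ParamRing k := fun i => ∏ s ∈ Finset.range (l + i + 1), P s
  have hQ0 : ∀ i, φ (Q i) ≠ 0 := fun i => hφ0 (Finset.prod_ne_zero_iff.2 fun s _ => hP0 s)
  -- The factor `Q 0` is common to all the denominators `Q i` and drops out of proportions; only `X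
  -- i`, the cost of the extra pole orders `l + 1, …, l + i`, remains.
  let X : ℕ → ParamRing k := fun i => ∏ s ∈ Finset.range i, P (l + 1 + s)
  have hX0 : ∀ i, X i ≠ 0 := fun i => Finset.prod_ne_zero_iff.2 fun s _ => hP0 _
  have hQX : ∀ i, Q i = Q 0 * X i := fun i => by
    simp only [Q, X]
    rw [show l + i + 1 = (l + 0 + 1) + i by omega, Finset.prod_range_add]
  have hXdeg : ∀ i, (X i).degreeOf v ≤ i * (N * paramDegree v f) := fun i => by
    refine (degreeOf_prod_le v _ _).trans ((Finset.sum_le_sum fun s _ => hPdeg _ v).trans ?_)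
    rw [Finset.sum_const, Finset.card_range, smul_eq_mul]
  -- the normal forms of the derivatives of order less than `r` are linearly independent
  have hind : LinearIndependent L fun (i : Fin r) x => φ (w i x) := by
    rw [Fintype.linearIndependent_iff]
    intro b hb
    by_contra! hex
    obtain ⟨i0, hi0⟩ := hex
    have hs : (Finset.univ.filter fun i => b i ≠ 0).Nonempty := ⟨i0, by simpa using hi0⟩
    set m := (Finset.univ.filter fun i => b i ≠ 0).max' hs with hm
    have hbm : b m ≠ 0 := by
      have := Finset.max'_mem _ hs
      rw [← hm] at this
      simpa using this
    have hzero : ∀ j, m < j → b j = 0 := by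
      intro j hj
      by_contra h
      exact absurd (Finset.le_max' (Finset.univ.filter fun i => b i ≠ 0) j (by simpa using h))
        (not_le.2 hj)
    -- Cutting a relation at its last nonzero coefficient gives a telescoper of order `m < r`,
    -- against minimality.
    let b' : Fin ((m : ℕ) + 1) → L := fun i => b ⟨i, by have := i.2; have := m.2; omega⟩
    have hb' : ∀ x, ∑ i, b' i * φ (w i x) = 0 := by
      intro x
      have h1 : ∑ i, b i * φ (w i x) = 0 := by simpa using congrFun hb x
      rw [← h1]
      refine Finset.sum_of_injOn (fun i => (⟨i, by have := i.2; have := m.2; omega⟩ : Fin r))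
        (fun i _ j _ hij => Fin.ext (by simpa using hij)) (fun _ _ => Finset.mem_univ _)
        (fun j _ hj => ?_) fun _ _ => rfl
      rw [hzero j ?_, zero_mul]
      by_contra hle
      refine hj ⟨⟨j, ?_⟩, Finset.mem_coe.2 (Finset.mem_univ _), rfl⟩
      have : (j : ℕ) ≤ m := not_lt.1 hle
      omega
    have h2 := hc.minimal m (fun i => b' i * φ (Q i)) (mul_ne_zero hbm (hQ0 _))
      (hasRegularCertificate_iff.2 ((hw _ b').1 hb'))
    have := m.2
    omega
  obtain ⟨I, hI⟩ := exists_det_ne_zero hind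
  let M : Matrix (Fin r) (Fin (r + 1)) (ParamRing k) := Matrix.of fun x j => w j (I x)
  have hdet : (M.submatrix id Fin.castSucc).det ≠ 0 := by
    intro h
    refine hI ?_
    have : (Matrix.of fun (x : Fin r) (j : Fin r) => φ (w j (I x))) =
        φ.mapMatrix (M.submatrix id Fin.castSucc) := rfl
    rw [this, ← RingHom.map_det, h, map_zero]
  -- The relation is between the normal forms of `Q i * ∂_t^i F`, hence the division by `Q i`.
  let lam : Fin (r + 1) → L := fun i => φ (c i) / φ (Q i)
  have hlamQ : ∀ i : Fin (r + 1), lam i * φ (Q i) = φ (c i) := fun i => div_mul_cancel₀ _ (hQ0 i)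
  have hlam0 : ∀ x, ∑ i, lam i * φ (w i x) = 0 := by
    refine (hw (r + 1) lam).2 ?_
    have := hasRegularCertificate_iff.1 hc.telescoper
    simp only [← hlamQ] at this
    exact this
  have hlam : (M.map φ).mulVec lam = 0 := by
    ext x
    simpa [Matrix.mulVec, dotProduct, M, mul_comm] using hlam0 (I x)
  have hmap : ∀ g : Fin r → Fin (r + 1),
      ((M.map φ).submatrix id g).det = φ (M.submatrix id g).det := fun g => by
    rw [RingHom.map_det]
    rfl
  let y : Fin (r + 1) → ParamRing k := fun i =>
    (-1) ^ (i : ℕ) * (M.submatrix id i.succAbove).det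
  let Y : Fin (r + 1) → ParamRing k := fun i => X i * y i
  have hylast : y (Fin.last r) = (-1) ^ r * (M.submatrix id Fin.castSucc).det := by
    simp only [y, Fin.succAbove_last, Fin.val_last]
  have hrel : ∀ i, c (Fin.last r) * Y i = Y (Fin.last r) * c i := by
    intro i
    have h1 := kernel_eq_minors (M.map φ) lam hlam (by rw [hmap]; exact hφ0 hdet) i
    rw [hmap, hmap] at h1
    have h2 : lam (Fin.last r) * φ (y i) = φ (y (Fin.last r)) * lam i := by
      rw [hylast]
      simpa [y] using h1
    refine mul_left_cancel₀ (hX0 0) (mul_left_cancel₀ (Finset.prod_ne_zero_iff.2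
      fun s _ => hP0 s : Q 0 ≠ 0) (hinj ?_))
    have h3 := hlamQ (Fin.last r)
    have h4 := hlamQ i
    rw [hQX] at h3 h4
    simp only [Y, map_mul, Fin.val_last] at h3 h4 ⊢
    change φ _ * (φ _ * (φ _ * (φ _ * φ _))) = φ _ * (φ _ * (φ _ * φ _ * φ _))
    rw [← h3, ← h4]
    linear_combination (φ (Q 0) * φ (X 0) * φ (Q 0) * φ (X r) * φ (X i)) * h2
  have hclast : c (Fin.last r) ≠ 0 := fun h => hc.leading_ne_zero (by rw [h, map_zero])
  have hYlast : Y (Fin.last r) ≠ 0 := by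
    refine mul_ne_zero (hX0 _) ?_
    rw [hylast]
    exact mul_ne_zero (pow_ne_zero _ (neg_ne_zero.2 one_ne_zero)) hdet
  rcases eq_or_ne (c i) 0 with h0 | h0
  · simp [h0]
  have hYi : Y i ≠ 0 := by
    refine right_ne_zero_of_mul (a := c (Fin.last r)) ?_
    rw [hrel]
    exact mul_ne_zero hYlast h0
  refine (degreeOf_le_of_dvd v hYi (dvd_of_primitive hclast hprim hrel i)).trans ?_
  set δ := paramDegree v f
  set A := paramDegree v a
  have hN1 : 1 ≤ N := by
    refine Nat.choose_pos ?_
    have : n + 1 ≤ (n + 1) * d := Nat.le_mul_of_pos_right _ hd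
    omega
  let wt : ℕ → ℕ := fun j => A + (l + (j + (j - 1))) * (N * δ)
  have hwt : ∀ (j : ℕ) x, (w j x).degreeOf v ≤ wt j := fun j x => by
    refine (show _ ≤ A + j * δ + (l + j - 1) * (N * δ) from hwdeg j x v).trans ?_
    have h1 : j * δ ≤ j * (N * δ) := Nat.mul_le_mul_left _ (Nat.le_mul_of_pos_left _ hN1)
    rcases j with _ | j
    · simp only [wt]
      have : (l + 0 - 1) * (N * δ) ≤ (l + (0 + (0 - 1))) * (N * δ) :=
        Nat.mul_le_mul_right _ (by omega)
      omega
    · simp only [wt, Nat.add_sub_cancel]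
      have e : l + (j + 1) - 1 = l + j := by omega
      rw [e]
      calc _ ≤ A + (j + 1) * (N * δ) + (l + j) * (N * δ) := by gcongr
        _ = _ := by ring
  have hy : (y i).degreeOf v ≤ ∑ j : Fin r, wt (i.succAbove j) := by
    have h1 : (M.submatrix id i.succAbove).det.degreeOf v ≤ ∑ j : Fin r, wt (i.succAbove j) :=
      degreeOf_det_le v _ _ fun x j => hwt _ _
    rcases neg_one_pow_eq_or (ParamRing k) (i : ℕ) with h | h
    · simpa only [y, h, one_mul] using h1
    · simpa only [y, h, neg_one_mul, degreeOf_neg] using h1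
  have hsum : ∑ j : Fin (r + 1), wt j = (r + 1) * A + ((r + 1) * l + r ^ 2) * (N * δ) := by
    rw [Fin.sum_univ_eq_sum_range wt, ← sum_add_pred r]
    simp only [wt, Finset.sum_add_distrib, ← Finset.sum_mul, Finset.sum_const, Finset.card_range,
      smul_eq_mul]
  rw [Fin.sum_univ_succAbove _ i] at hsum
  -- Omitting column `i` saves at least this much; its part `i * (N * δ)` pays exactly for the
  -- factor `X i` of `Y i`.
  have hwti : A + (l + i) * (N * δ) ≤ wt i := by
    simp only [wt]
    gcongr
    omega
  have htot : (Y i).degreeOf v ≤ i * (N * δ) + ∑ j : Fin r, wt (i.succAbove j) :=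
    (degreeOf_mul_le _ _ _).trans (add_le_add (hXdeg i) hy)
  nlinarith

end Telescoper

end Telescoping

namespace Telescoping

open MvPolynomial

/-! ### Consequences of regularity and homogeneity of the data. -/

section Homogeneity

variable {L : Type*} [Field L] {n : ℕ} {f : MvPolynomial (Fin (n + 1)) L}

/-- If all derivatives vanished, some power of a variable would be zero. This supplies `f ≠ 0` and
`1 ≤ d` in the main theorem. -/
theorem exists_pderiv_ne_zero (hreg : IsRegularPoly f) {e : ℤ}
    (hf : ∀ i, pderiv i f ∈ homZ (Fin (n + 1)) L e) : ∃ i, pderiv i f ≠ 0 := by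
  by_contra! h
  have h1 := X_mem_radical_of_finite (F := fun i => pderiv i f) hf hreg 0
  have h2 : Ideal.span (Set.range fun i : Fin (n + 1) => pderiv i f) = ⊥ := by
    simp [h]
  rw [h2] at h1
  obtain ⟨N, hN⟩ := h1
  exact pow_ne_zero N (X_ne_zero (R := L) (0 : Fin (n + 1))) hN

theorem mem_homZ_of_mul_mem {σ R : Type*} [CommRing R] [IsDomain R] {p q : MvPolynomial σ R}
    {D E F : ℤ} (hq : q ∈ homZ σ R E) (hq0 : q ≠ 0) (h : D + E = F) (hpq : p * q ∈ homZ σ R F) :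
    p ∈ homZ σ R D := by
  have h1 := homComp_mul (p := p) hq h
  rw [homComp_of_mem hpq] at h1
  rw [mul_right_cancel₀ hq0 h1]
  exact homComp_mem D p

/-- The homogeneous representative `g / f^m` may differ from `a / f^l`; cross-multiplying and
cancelling `f^m` moves homogeneity to `a`. -/
theorem mem_homZ_of_isHomogeneousAway (K : Type*) [Field K]
    [Algebra (MvPolynomial (Fin (n + 1)) L) K] [IsFractionRing (MvPolynomial (Fin (n + 1)) L) K]
    (hf0 : f ≠ 0) {d l : ℕ} (hf : f ∈ homZ (Fin (n + 1)) L d) {a : MvPolynomial (Fin (n + 1)) L}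
    {p : ℤ} (ha : IsHomogeneousAway K f d p (frac K a f l)) :
    a ∈ homZ (Fin (n + 1)) L (p + l * d) := by
  obtain ⟨g, m, e, hg, he, h⟩ := ha
  refine mem_homZ_of_mul_mem (pow_mem_homZ hf m) (pow_ne_zero m hf0) rfl ?_
  have h1 : a * f ^ m = g * f ^ l := by
    refine frac_injective (K := K) (m := l + m) hf0 ?_
    rw [frac_mul_pow K hf0, add_comm l m, frac_mul_pow K hf0, h]
  rw [h1]
  exact mul_mem_homZ (IsHomogeneous.mem_homZ hg) (pow_mem_homZ hf l) (by rw [he]; ring)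

theorem mem_homZ_of_map_mem {σ R T : Type*} [CommRing R] [CommRing T] {φ : R →+* T}
    (hφ : Function.Injective φ) {D : ℤ} {p : MvPolynomial σ R} (h : map φ p ∈ homZ σ T D) :
    p ∈ homZ σ R D := fun m hm =>
  h m (by rw [coeff_map]; exact (map_ne_zero_iff φ hφ).2 hm)

end Homogeneity

end Telescoping

/-! ### The bound with `e^n d^n`. -/

open MvPolynomial in
theorem mainTheorem7 {k L K : Type*} [Field k] [CharZero k] (n d l r : ℕ) (hn : 1 ≤ n)
    [Field L] [Algebra (Telescoping.ParamRing k) L] [IsFractionRing (Telescoping.ParamRing k) L]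
    [Field K] [Algebra (MvPolynomial (Fin (n + 1)) L) K]
    [IsFractionRing (MvPolynomial (Fin (n + 1)) L) K]
    (f a : MvPolynomial (Fin (n + 1)) (Telescoping.ParamRing k))
    (fL aL : MvPolynomial (Fin (n + 1)) L)
    (hfL : fL = MvPolynomial.map (algebraMap (Telescoping.ParamRing k) L) f)
    (haL : aL = MvPolynomial.map (algebraMap (Telescoping.ParamRing k) L) a)
    (hf : f.IsHomogeneous d)
    (hreg : Telescoping.IsRegularPoly fL)
    (ha : Telescoping.IsHomogeneousAway K fL d (-(n : ℤ) - 1) (Telescoping.frac K aL fL l))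
    (c : Fin (r + 1) → Telescoping.ParamRing k)
    (hc : Telescoping.IsMinimalTelescoper k fL (Telescoping.frac K aL fL l)
      (fun i => algebraMap (Telescoping.ParamRing k) L (c i)))
    (hprim : ∀ g : Telescoping.ParamRing k, (∀ i, g ∣ c i) → IsUnit g) :
    ∀ (i : Fin (r + 1)) (v : Fin 2),
      ((c i).degreeOf v : ℝ) ≤ r * (Telescoping.paramDegree v a : ℝ) +
        ((r : ℝ) ^ 2 + r * l) * Real.exp 1 ^ n * (d : ℝ) ^ n *
          (Telescoping.paramDegree v f : ℝ) := by
  intro i v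
  subst hfL haL
  have hinj := IsFractionRing.injective (Telescoping.ParamRing k) L
  have hfZ := Telescoping.IsHomogeneous.mem_homZ hf
  have hfLZ := Telescoping.map_mem_homZ (algebraMap (Telescoping.ParamRing k) L) hfZ
  obtain ⟨j, hj⟩ := Telescoping.exists_pderiv_ne_zero hreg
    fun i => Telescoping.pderiv_mem_homZ hfLZ i rfl
  have hfL0 : map (algebraMap (Telescoping.ParamRing k) L) f ≠ 0 := by
    rintro h
    exact hj (by rw [h, map_zero])
  have hf0 : f ≠ 0 := by
    rintro rfl
    exact hfL0 (map_zero _)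
  have hd : 1 ≤ d := by
    by_contra h
    exact hj (Telescoping.homZ_neg (by omega) (Telescoping.pderiv_mem_homZ hfLZ j rfl))
  have haZ := Telescoping.mem_homZ_of_map_mem hinj
    (Telescoping.mem_homZ_of_isHomogeneousAway K hfL0 hfLZ ha)
  rw [show -(n : ℤ) - 1 + l * d = l * d - n - 1 by ring] at haZ
  have h := Telescoping.degreeOf_minimalTelescoper_le (K := K) hn hd hf0 hfZ haZ hreg hc hprim i v
  have h' : ((c i).degreeOf v : ℝ) ≤ r * (Telescoping.paramDegree v a : ℝ) +
      ((r : ℝ) ^ 2 + r * l) * ((((n + 1) * d - 1).choose n : ℝ) * Telescoping.paramDegree v f) := by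
    exact_mod_cast h
  refine h'.trans ?_
  have hchoose := Telescoping.choose_le_exp_mul_pow n d
  rw [mul_assoc ((r : ℝ) ^ 2 + r * l), mul_assoc ((r : ℝ) ^ 2 + r * l)]
  gcongr
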